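/- **Theorem 1.** Let $\mathcal X,\mathcal A,\mathcal Y$ be finite sets, $P_X$ a pmf on $\mathcal X$, $P_{Y|X,A}$ a channel from $\mathcal X\times\mathcal A$ to $\mathcal Y$, and $\Lambda:\mathcal A\to\mathbb R$ a cost function. A $(2^{nR_X},2^{nR_Y},n)$ code (case A, actions taken at the decoder) consists of encoders $T_1:\mathcal X^n\to\{1,\dots,\lfloor 2^{nR_X}\rfloor\}$ and $T_2:\mathcal Y^n\to\{1,\dots,\lfloor 2^{nR_Y}\rfloor\}$, a strategy $h:\{1,\dots,\lfloor 2^{nR_X}\rfloor\}\to\mathcal A^n$ and a decoder $g:\{1,\dots,\lfloor 2^{nR_X}\rfloor\}\times\{1,\dots,\lfloor 2^{nR_Y}\rfloor\}\to\mathcal X^n\times\mathcal Y^n$. The source $X^n$ is i.i.d. with pmf $P_X$, the actions are $A^n=h(T_1(X^n))$, and, given $X^n=x^n$ and $A^n=a^n$, the source $Y^n$ has law $\prod_{i=1}^n P_{Y|X,A}(y_i|x_i,a_i)$. A pair $(R_X,R_Y)$ is achievable for the cost constraint $\Gamma\in\mathbb R$ if there is a sequence of $(2^{nR_X},2^{nR_Y},n)$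 codes, $n=1,2,\dots$, each with $E\big[\frac1n\sum_{i=1}^n\Lambda(A_i)\big]\le\Gamma$, such that $\Pr\big((X^n,Y^n)\ne g(T_1(X^n),T_2(Y^n))\big)\to0$ as $n\to\infty$. Let $\mathcal S$ be the closure of the set of triples $(R_X,R_Y,\Gamma)\in\mathbb R^3$ for which there is a conditional pmf $P_{A|X}$ such that, under the joint law $P_{X,A,Y}=P_XP_{A|X}P_{Y|X,A}$, one has $E[\Lambda(A)]\le\Gamma$ and $$R_X\ge H(X|Y,A)+I(X;A),\qquad R_Y\ge H(Y|X,A),\qquad R_X+R_Y\ge H(X,Y|A)+I(X;A),$$ where entropies and mutual information are in bits. Then the optimal rate region is $\mathcal S$, that is: for every $\Gamma\in\mathbb R$ the convex closure (closure of the convex hull) of the set of pairs $(R_X,R_Y)$ achievable for $\Gamma$ equals $\{(R_X,R_Y):(R_X,R_Y,\Gamma)\in\mathcal S\}$; and the convex closure in $\mathbb R^3$ of the set of triples $(R_X,R_Y,\Gamma)$ such that $(R_X,R_Y)$ is achievable for $\Gamma$ equals $\mathcal S$. -/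

import Mathlib

open scoped BigOperators Topology

namespace ActionCoding

noncomputable section

/-! Information measures, in bits, of random variables defined on a discrete probability space. -/

/-- The probability that the random variable `U` takes the value `u`. -/
def prob {Ω α : Type*} (q : PMF Ω) (U : Ω → α) (u : α) : ℝ :=
  (q.map U u).toReal

/-- Conditional entropy
`H(U | V) = - ∑ p(u, v) log p(u | v)`, with base-two logarithms and `0 log 0 = 0`. -/
def condEntropy {Ω α β : Type*} [Fintype α] [Fintype β]
    (q : PMF Ω) (U : Ω → α) (V : Ω → β) : ℝ :=
  -∑ u, ∑ v, prob q (fun ω => (U ω, V ω)) (u, v) *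
      Real.logb 2 (prob q (fun ω => (U ω, V ω)) (u, v) / prob q V v)

/-- Mutual information
`I(U ; V) = ∑ p(u, v) log (p(u, v) / (p(u) p(v)))`, with base-two logarithms
and `0 log 0 = 0`. -/
def mutualInfo {Ω α β : Type*} [Fintype α] [Fintype β]
    (q : PMF Ω) (U : Ω → α) (V : Ω → β) : ℝ :=
  ∑ u, ∑ v, prob q (fun ω => (U ω, V ω)) (u, v) *
      Real.logb 2 (prob q (fun ω => (U ω, V ω)) (u, v) / (prob q U u * prob q V v))

/-! Block codes for correlated sources with actions taken at the decoder. -/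

/-- The message set `{1, …, 2 ^ (n R)}`: it has `⌊2 ^ (n R)⌋` elements. -/
abbrev Message (n : ℕ) (R : ℝ) : Type :=
  Fin ⌊(2 : ℝ) ^ ((n : ℝ) * R)⌋₊

/-- A `(2 ^ (n R_X), 2 ^ (n R_Y), n)` code: the two encoders, the strategy by which the decoder
chooses the actions from the first message, and the decoding function. -/
structure Code (X A Y : Type*) (n : ℕ) (RX RY : ℝ) where
  encX : (Fin n → X) → Message n RX
  encY : (Fin n → Y) → Message n RY
  strategy : Message n RX → (Fin n → A)
  decode : Message n RX → Message n RY → (Fin n → X) × (Fin n → Y)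

namespace Code

variable {X A Y : Type*} {n : ℕ} {RX RY : ℝ}

/-- The action sequence that results from the source sequence `x`. -/
def actions (c : Code X A Y n RX RY) (x : Fin n → X) : Fin n → A :=
  c.strategy (c.encX x)

/-- The probability that `(X^n, Y^n) = (x, y)`: the first source is i.i.d. with law `P`, and the
second source is the output of the memoryless channel `W`, whose inputs are the first source
and the actions. -/
def sourceProb (c : Code X A Y n RX RY) (P : PMF X) (W : X → A → PMF Y)
    (x : Fin n → X) (y : Fin n → Y) : ℝ :=
  (∏ i, (P (x i)).toReal) * ∏ i, (W (x i) (c.actions x i) (y i)).toReal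

open Classical in
/-- The probability of error `Pr((X^n, Y^n) ≠ g(T₁, T₂))`. -/
def errorProb [Fintype X] [Fintype Y] (c : Code X A Y n RX RY)
    (P : PMF X) (W : X → A → PMF Y) : ℝ :=
  ∑ x : Fin n → X, ∑ y : Fin n → Y,
    if (x, y) ≠ c.decode (c.encX x) (c.encY y) then c.sourceProb P W x y else 0

/-- The expected cost `E[(1 / n) ∑ Λ(A_i)]`. The actions are a function of `X^n` alone, so only
the law of `X^n` enters. -/
def expectedCost [Fintype X] (c : Code X A Y n RX RY) (P : PMF X) (Λ : A → ℝ) : ℝ :=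
  ∑ x : Fin n → X, (∏ i, (P (x i)).toReal) * ((1 / (n : ℝ)) * ∑ i, Λ (c.actions x i))

end Code

variable {X A Y : Type*} [Fintype X] [Fintype A] [Fintype Y]

/-- The rate pair `(RX, RY)` is achievable under the cost constraint `Γ`: there is a sequence of
codes, one for every block length `n ≥ 1`, all satisfying the cost constraint, with error
probability tending to zero. (The code of block length `0`, which always exists, is a dummy.) -/
def Achievable (P : PMF X) (W : X → A → PMF Y) (Λ : A → ℝ) (Γ RX RY : ℝ) : Prop :=
  ∃ c : ∀ n : ℕ, Code X A Y n RX RY,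
    (∀ n : ℕ, 1 ≤ n → (c n).expectedCost P Λ ≤ Γ) ∧
      Filter.Tendsto (fun n => (c n).errorProb P W) Filter.atTop (𝓝 0)

/-- The optimal rate region for the cost constraint `Γ`: the convex closure of the set of
achievable rate pairs. -/
def optimalRateRegion (P : PMF X) (W : X → A → PMF Y) (Λ : A → ℝ) (Γ : ℝ) : Set (ℝ × ℝ) :=
  closure (convexHull ℝ {R : ℝ × ℝ | Achievable P W Λ Γ R.1 R.2})

/-- The optimal region in the space of triples `(RX, RY, Γ)`: the convex closure of the set of
triples for which `(RX, RY)` is achievable under the cost constraint `Γ`. -/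
def optimalTripleRegion (P : PMF X) (W : X → A → PMF Y) (Λ : A → ℝ) : Set (ℝ × ℝ × ℝ) :=
  closure (convexHull ℝ {r : ℝ × ℝ × ℝ | Achievable P W Λ r.2.2 r.1 r.2.1})

/-! The single-letter region. -/

/-- The joint law `P_{X,A,Y} = P_X P_{A|X} P_{Y|X,A}`, with `K` in the role of `P_{A|X}` and `W` in
the role of `P_{Y|X,A}`. -/
def jointLaw {X A Y : Type*} (P : PMF X) (K : X → PMF A) (W : X → A → PMF Y) :
    PMF (X × A × Y) :=
  P.bind fun x => (K x).bind fun a => (W x a).map fun y => (x, a, y)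

/-- The coordinate random variable `X`. -/
def rvX {X A Y : Type*} (ω : X × A × Y) : X := ω.1

/-- The coordinate random variable `A`. -/
def rvA {X A Y : Type*} (ω : X × A × Y) : A := ω.2.1

/-- The coordinate random variable `Y`. -/
def rvY {X A Y : Type*} (ω : X × A × Y) : Y := ω.2.2

/-- The pair of two random variables. -/
def rvPair {Ω α β : Type*} (U : Ω → α) (V : Ω → β) (ω : Ω) : α × β := (U ω, V ω)

/-- The set of triples `(RX, RY, Γ)` for which there is a conditional law `K` of the action given
`X` such that, under the joint law `P_X P_{A|X} P_{Y|X,A}`,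
`RX ≥ H(X|Y,A) + I(X;A)`, `RY ≥ H(Y|X,A)`, `RX + RY ≥ H(X,Y|A) + I(X;A)` and `E[Λ(A)] ≤ Γ`. -/
def singleLetterRegion (P : PMF X) (W : X → A → PMF Y) (Λ : A → ℝ) : Set (ℝ × ℝ × ℝ) :=
  {r | ∃ K : X → PMF A,
    condEntropy (jointLaw P K W) rvX (rvPair rvY rvA)
        + mutualInfo (jointLaw P K W) rvX rvA ≤ r.1 ∧
    condEntropy (jointLaw P K W) rvY (rvPair rvX rvA) ≤ r.2.1 ∧
    condEntropy (jointLaw P K W) (rvPair rvX rvY) rvA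
        + mutualInfo (jointLaw P K W) rvX rvA ≤ r.1 + r.2.1 ∧
    ∑ a, prob (jointLaw P K W) rvA a * Λ a ≤ r.2.2}

end

end ActionCoding

namespace ActionCoding

/-! Sums over finite products. -/

/-! In nats, the three single-letter bounds are H(X) - I(X;Y|A), H(Y|X,A) and H(X) + H(Y|X,A). As
functions of the kernel P_{A|X}, the last two and the mean cost are linear, while the first is
convex: it is a maximum, over test channels Q(y|a), of linear functions (`avg_le_rateX`). Kernels
form a compact set, so the region is already convex and closed (`convex_weightRegion`,
`isClosed_weightRegion`). Neither the closure nor the convex hull adds anything to it, and it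
remains to compare it with the achievable triples.

Converse (`mem_weightRegion_of_code`). Averaging the law of (X_i, A_i) over the time index i gives
one kernel that computes the expectation of every additive function. For the law p of (X^n, Y^n) and
a density r, the Gibbs inequality bounds E log(r/p) by the logarithm of the r-mass of correct
decoding, plus a Fano term (`sum_mul_log_sub_le`). The products of P_{Y|A} and of P_X, and the
constant 1, serve as r; the masses are then at most the number of first messages, of second
messages, and of pairs of messages. Taking P_{Y|A} from the averaged kernel makes a chain rule
unnecessary. Closedness of the region disposes of the loss as n grows.

Achievability (`exists_one_shot_code`, `achievable_of_lt`). The first encoder sends the index of an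
action codeword that covers x, at rate I(X;A), and a bin of x; the second sends a bin of y. Since Y
is generated only after the action is chosen, covering uses a property of (x, a) alone: given (x,
a), the outcome y is typical with high probability. Markov's inequality shows that most pairs have
it. The decoder knows the codeword and searches both bins for a typical pair; wrong candidates in x,
in y, or in both cost H(X|Y,A), H(Y|X,A) and H(X,Y|A).

The cost bound must hold exactly for a fixed Γ (`achievable_of_mem_weightRegion`). If some action
costs less than Γ, mixing in a little of it makes the mean cost strict; otherwise every action in
use costs exactly Γ. -/

theorem sum_prod_pi {ι α : Type*} [Fintype ι] [DecidableEq ι] [Fintype α] (f : ι → α → ℝ) :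
    ∑ x : ι → α, ∏ i, f i (x i) = ∏ i, ∑ a, f i a := by
  rw [Finset.prod_univ_sum, Fintype.piFinset_univ]

theorem sum_prod_eq_one {ι α : Type*} [Fintype ι] [DecidableEq ι] [Fintype α] {f : ι → α → ℝ}
    (hf : ∀ i, ∑ a, f i a = 1) : ∑ x : ι → α, ∏ i, f i (x i) = 1 := by
  rw [sum_prod_pi]; simp [hf]

theorem sum_prod_mul_apply {ι α : Type*} [Fintype ι] [DecidableEq ι] [Fintype α] {f : ι → α → ℝ}
    (hf : ∀ i, ∑ a, f i a = 1) (i : ι) (φ : α → ℝ) :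
    ∑ x : ι → α, (∏ j, f j (x j)) * φ (x i) = ∑ a, f i a * φ a := by
  have h : ∀ x : ι → α, (∏ j, f j (x j)) * φ (x i) =
      ∏ j, f j (x j) * (if j = i then φ (x j) else 1) := by
    intro x
    rw [Finset.prod_mul_distrib, Finset.prod_ite_eq' Finset.univ i (fun j => φ (x j))]
    simp
  simp_rw [h]
  rw [sum_prod_pi (fun j a => f j a * (if j = i then φ a else 1)),
    Finset.prod_eq_single i]
  · simp
  · intro j _ hj
    simp [hj, hf]
  · simp

theorem sum_prod_mul_sum_apply {ι α : Type*} [Fintype ι] [DecidableEq ι] [Fintype α] {f : ι → α → ℝ}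
    (hf : ∀ i, ∑ a, f i a = 1) (φ : ι → α → ℝ) :
    ∑ x : ι → α, (∏ j, f j (x j)) * ∑ i, φ i (x i) = ∑ i, ∑ a, f i a * φ i a := by
  simp_rw [Finset.mul_sum]
  rw [Finset.sum_comm]
  exact Finset.sum_congr rfl fun i _ => sum_prod_mul_apply hf i (φ i)

/-! The inequality of Gibbs and a consequence in the spirit of Fano. -/

/-- Termwise this is log t ≤ t - 1 at t = q/p. Total mass at most one is allowed for `q` because the
conditional laws used later vanish identically at actions of probability zero. -/
theorem sum_mul_log_le {Ω : Type*} [Fintype Ω] {p q : Ω → ℝ} (hp : p ∈ stdSimplex ℝ Ω)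
    (hqs : ∑ ω, q ω ≤ 1) (hq : ∀ ω, 0 ≤ q ω) (hpq : ∀ ω, 0 < p ω → 0 < q ω) :
    ∑ ω, p ω * Real.log (q ω) ≤ ∑ ω, p ω * Real.log (p ω) := by
  have h : ∀ ω, p ω * Real.log (q ω) - p ω * Real.log (p ω) ≤ q ω - p ω := by
    intro ω
    rcases (hp.1 ω).eq_or_lt with h0 | h0
    · rw [← h0]; simpa using hq ω
    · have hq0 := hpq ω h0
      rw [← mul_sub, ← Real.log_div hq0.ne' h0.ne']
      have := Real.log_le_sub_one_of_pos (div_pos hq0 h0)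
      calc p ω * Real.log (q ω / p ω) ≤ p ω * (q ω / p ω - 1) :=
            mul_le_mul_of_nonneg_left this h0.le
        _ = q ω - p ω := by field_simp
  have := Finset.sum_le_sum fun ω (_ : ω ∈ Finset.univ) => h ω
  rw [Finset.sum_sub_distrib, Finset.sum_sub_distrib, hp.2] at this
  linarith

open Classical in
/-- If the density `r` puts mass at most `M` on the event `C` and at most `N` in total, then the
divergence of `r` from `p` is controlled by `M` and the probability of the complement of `C`. -/
theorem sum_mul_log_sub_le {Ω : Type*} [Fintype Ω] {p r : Ω → ℝ} (hp : p ∈ stdSimplex ℝ Ω)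
    (hr : ∀ ω, 0 ≤ r ω) (hpr : ∀ ω, 0 < p ω → 0 < r ω) (C : Ω → Prop) {M N : ℝ} (hM : 1 ≤ M)
    (hN : 1 ≤ N) (hCM : ∑ ω, (if C ω then r ω else 0) ≤ M) (hrN : ∑ ω, r ω ≤ N) :
    ∑ ω, p ω * Real.log (r ω) - ∑ ω, p ω * Real.log (p ω) ≤
      Real.log 2 + Real.log M + (∑ ω, if C ω then 0 else p ω) * Real.log N := by
  have hM0 : 0 < M := by linarith
  have hN0 : 0 < N := by linarith
  -- An even mixture of `r` restricted to `C`, scaled by `M`, and of all of `r`, scaled by `N`. The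
  -- first half gives the bound on `C`; the second keeps `q` positive wherever `p` is.
  set q : Ω → ℝ := fun ω => ((if C ω then r ω else 0) / M + r ω / N) / 2 with hqdef
  have hC0 : ∀ ω, 0 ≤ (if C ω then r ω else 0) := by
    intro ω; split_ifs
    · exact hr ω
    · exact le_rfl
  have hq : ∀ ω, 0 ≤ q ω := fun ω => by
    have := hC0 ω
    have := hr ω
    positivity
  have hqs : ∑ ω, q ω ≤ 1 := by
    simp only [hqdef]
    rw [← Finset.sum_div, Finset.sum_add_distrib, ← Finset.sum_div, ← Finset.sum_div]
    have h1 := (div_le_one hM0).2 hCM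
    have h2 := (div_le_one hN0).2 hrN
    linarith
  have hpq : ∀ ω, 0 < p ω → 0 < q ω := fun ω h => by
    have := hC0 ω
    have := hpr ω h
    positivity
  have hg := sum_mul_log_le hp hqs hq hpq
  have hb : ∀ ω, p ω * Real.log (r ω) - p ω * (Real.log 2 + Real.log M) -
      (if C ω then 0 else p ω) * Real.log N ≤ p ω * Real.log (q ω) := by
    intro ω
    rcases (hp.1 ω).eq_or_lt with h0 | h0
    · rw [← h0]; simp
    have hr0 := hpr ω h0
    by_cases hC : C ω
    · have : Real.log (r ω / (2 * M)) ≤ Real.log (q ω) := by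
        apply Real.log_le_log (by positivity)
        simp only [hqdef, hC, if_true]
        have : 0 ≤ r ω / N := by positivity
        have : r ω / (2 * M) = r ω / M / 2 := by field_simp
        linarith
      rw [Real.log_div hr0.ne' (by positivity), Real.log_mul (by norm_num) hM0.ne'] at this
      have := mul_le_mul_of_nonneg_left this h0.le
      simp only [hC, if_true]
      linarith
    · have : Real.log (q ω) = Real.log (r ω) - (Real.log 2 + Real.log N) := by
        rw [← Real.log_mul (by norm_num) hN0.ne', ← Real.log_div hr0.ne' (by positivity)]
        congr 1
        simp only [hqdef, hC, if_false]
        field_simp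
        ring
      rw [this]
      simp only [hC, if_false]
      have := mul_nonneg h0.le (Real.log_nonneg hM)
      linarith
  have := Finset.sum_le_sum fun ω (_ : ω ∈ Finset.univ) => hb ω
  rw [Finset.sum_sub_distrib, Finset.sum_sub_distrib, ← Finset.sum_mul, ← Finset.sum_mul,
    hp.2] at this
  linarith

/-! A large deviation bound for independent, identically distributed variables. -/

/-- The moment generating function equals 1 at 0, and its derivative there is the negative mean. -/
theorem exists_sum_mul_exp_lt_one {Ω : Type*} [Fintype Ω] {p : Ω → ℝ} (hp : p ∈ stdSimplex ℝ Ω)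
    {ψ : Ω → ℝ} (h : ∑ ω, p ω * ψ ω < 0) :
    ∃ s : ℝ, 0 < s ∧ ∑ ω, p ω * Real.exp (s * ψ ω) < 1 := by
  have hd : HasDerivAt (fun s : ℝ => ∑ ω, p ω * Real.exp (s * ψ ω)) (∑ ω, p ω * ψ ω) 0 := by
    apply HasDerivAt.fun_sum
    intro ω _
    have h1 : HasDerivAt (fun s : ℝ => s * ψ ω) (ψ ω) 0 := by
      simpa using (hasDerivAt_id (0 : ℝ)).mul_const (ψ ω)
    simpa using (h1.exp).const_mul (p ω)
  have ht := hasDerivAt_iff_tendsto_slope.1 hd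
  have he : ∀ᶠ s in 𝓝[≠] (0 : ℝ), slope (fun s : ℝ => ∑ ω, p ω * Real.exp (s * ψ ω)) 0 s < 0 :=
    ht.eventually (gt_mem_nhds h)
  have he' : ∀ᶠ s in 𝓝[>] (0 : ℝ), slope (fun s : ℝ => ∑ ω, p ω * Real.exp (s * ψ ω)) 0 s < 0 :=
    he.filter_mono (nhdsWithin_mono (0 : ℝ) fun (s : ℝ) (hs : 0 < s) => hs.ne')
  obtain ⟨s, hs, hs0⟩ := (he'.and self_mem_nhdsWithin).exists
  refine ⟨s, hs0, ?_⟩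
  have hs0' : (0 : ℝ) < s := hs0
  rw [slope_def_field] at hs
  simp only [zero_mul, Real.exp_zero, mul_one, hp.2, sub_zero] at hs
  have := (div_neg_iff.1 hs)
  rcases this with h | h <;> linarith [h.1, h.2]

open Classical in
-- Chernoff bound: the indicator of the event is at most exp(s ∑ (φ - μ)), whose expectation is the
-- n-th power of a number below 1.
theorem tendsto_sum_tail {Ω : Type*} [Fintype Ω] {p : Ω → ℝ} (hp : p ∈ stdSimplex ℝ Ω)
    {φ : Ω → ℝ} {μ : ℝ} (h : ∑ ω, p ω * φ ω < μ) :
    Filter.Tendsto (fun n : ℕ => ∑ ω : Fin n → Ω,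
      if n * μ < ∑ i, φ (ω i) then ∏ i, p (ω i) else 0) Filter.atTop (𝓝 0) := by
  obtain ⟨s, hs, hlt⟩ := exists_sum_mul_exp_lt_one hp (ψ := fun ω => φ ω - μ) (by
    simp_rw [mul_sub]
    rw [Finset.sum_sub_distrib, ← Finset.sum_mul, hp.2]; linarith)
  have h0 : 0 ≤ ∑ ω, p ω * Real.exp (s * (φ ω - μ)) :=
    Finset.sum_nonneg fun ω _ => mul_nonneg (hp.1 ω) (Real.exp_pos _).le
  refine squeeze_zero (fun n => ?_) (fun n => ?_) (tendsto_pow_atTop_nhds_zero_of_lt_one h0 hlt)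
  · refine Finset.sum_nonneg fun ω _ => ?_
    split_ifs
    · exact Finset.prod_nonneg fun i _ => hp.1 _
    · exact le_rfl
  · have : (∑ ω, p ω * Real.exp (s * (φ ω - μ))) ^ n =
        ∑ ω : Fin n → Ω, ∏ i, p (ω i) * Real.exp (s * (φ (ω i) - μ)) := by
      rw [sum_prod_pi (fun (_ : Fin n) ω => p ω * Real.exp (s * (φ ω - μ)))]
      simp
    rw [this]
    refine Finset.sum_le_sum fun ω _ => ?_
    have hnn : 0 ≤ ∏ i, p (ω i) := Finset.prod_nonneg fun i _ => hp.1 _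
    rw [Finset.prod_mul_distrib, ← Real.exp_sum, ← Finset.mul_sum, Finset.sum_sub_distrib]
    split_ifs with hc
    · refine le_mul_of_one_le_right hnn (Real.one_le_exp ?_)
      simp only [Finset.sum_const, Finset.card_univ, Fintype.card_fin, nsmul_eq_mul]
      exact mul_nonneg hs.le (by linarith)
    · exact mul_nonneg hnn (Real.exp_pos _).le

/-! The single-letter quantities, in nats and as functions of real weights. -/

/-- The expectation of `φ (X, A, Y)` under the law `P k w`. -/
noncomputable def avg {X A Y : Type*} [Fintype X] [Fintype A] [Fintype Y] (P : X → ℝ)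
    (k : X → A → ℝ) (w : X → A → Y → ℝ) (φ : X → A → Y → ℝ) : ℝ :=
  ∑ x, ∑ a, ∑ y, P x * k x a * w x a y * φ x a y

/-- The law of the action. -/
noncomputable def margA {X A : Type*} [Fintype X] (P : X → ℝ) (k : X → A → ℝ) (a : A) : ℝ :=
  ∑ x, P x * k x a

/-- The law of the action together with the second source. -/
noncomputable def margAY {X A Y : Type*} [Fintype X] (P : X → ℝ)
    (k : X → A → ℝ) (w : X → A → Y → ℝ) (a : A) (y : Y) : ℝ :=
  ∑ x, P x * k x a * w x a y

section Rates

set_option linter.unusedSectionVars false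

variable {X A Y : Type*} [Fintype X] [Fintype A] [Fintype Y]

/-- `H(X | Y, A) + I(X; A)` in nats. -/
noncomputable def rateX (P : X → ℝ) (k : X → A → ℝ) (w : X → A → Y → ℝ) : ℝ :=
  avg P k w fun x a y =>
    -Real.log (P x) - Real.log (w x a y) + Real.log (margAY P k w a y / margA P k a)

/-- `H(Y | X, A)` in nats. -/
noncomputable def rateY (P : X → ℝ) (k : X → A → ℝ) (w : X → A → Y → ℝ) : ℝ :=
  avg P k w fun x a y => -Real.log (w x a y)

/-- `H(X, Y | A) + I(X; A)` in nats. -/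
noncomputable def rateSum (P : X → ℝ) (k : X → A → ℝ) (w : X → A → Y → ℝ) : ℝ :=
  avg P k w fun x a y => -Real.log (P x) - Real.log (w x a y)

/-- The single-letter region in terms of real weights. -/
def weightRegion (P : X → ℝ) (w : X → A → Y → ℝ) (Λ : A → ℝ) : Set (ℝ × ℝ × ℝ) :=
  {r | ∃ k : X → A → ℝ, (∀ x, k x ∈ stdSimplex ℝ A) ∧
    rateX P k w ≤ r.1 * Real.log 2 ∧ rateY P k w ≤ r.2.1 * Real.log 2 ∧
    rateSum P k w ≤ (r.1 + r.2.1) * Real.log 2 ∧ ∑ x, ∑ a, P x * k x a * Λ a ≤ r.2.2}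

variable {P : X → ℝ} {k : X → A → ℝ} {w : X → A → Y → ℝ}

theorem avg_add (φ ψ : X → A → Y → ℝ) :
    avg P k w (fun x a y => φ x a y + ψ x a y) = avg P k w φ + avg P k w ψ := by
  simp only [avg, mul_add, Finset.sum_add_distrib]

theorem avg_sub (φ ψ : X → A → Y → ℝ) :
    avg P k w (fun x a y => φ x a y - ψ x a y) = avg P k w φ - avg P k w ψ := by
  simp only [avg, mul_sub, Finset.sum_sub_distrib]

theorem avg_neg (φ : X → A → Y → ℝ) :
    avg P k w (fun x a y => - φ x a y) = - avg P k w φ := by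
  simp only [avg, mul_neg, Finset.sum_neg_distrib]

/-- Identities between logarithms need positive arguments, so they are only available on the
support; elsewhere the weight is zero. -/
theorem avg_congr (hP : ∀ x, 0 ≤ P x) (hk : ∀ x a, 0 ≤ k x a) (hw : ∀ x a y, 0 ≤ w x a y)
    {φ ψ : X → A → Y → ℝ}
    (h : ∀ x a y, 0 < P x → 0 < k x a → 0 < w x a y → φ x a y = ψ x a y) :
    avg P k w φ = avg P k w ψ := by
  refine Finset.sum_congr rfl fun x _ => Finset.sum_congr rfl fun a _ =>
    Finset.sum_congr rfl fun y _ => ?_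
  rcases (hP x).eq_or_lt with h1 | h1
  · simp [← h1]
  rcases (hk x a).eq_or_lt with h2 | h2
  · simp [← h2]
  rcases (hw x a y).eq_or_lt with h3 | h3
  · simp [← h3]
  rw [h x a y h1 h2 h3]

theorem avg_fst_snd (hw : ∀ x a, ∑ y, w x a y = 1) (ψ : X → A → ℝ) :
    avg P k w (fun x a _ => ψ x a) = ∑ x, ∑ a, P x * k x a * ψ x a := by
  refine Finset.sum_congr rfl fun x _ => Finset.sum_congr rfl fun a _ => ?_
  rw [← Finset.sum_mul, ← Finset.mul_sum, hw, mul_one]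

theorem avg_snd (g : A → Y → ℝ) :
    avg P k w (fun _ a y => g a y) = ∑ a, ∑ y, margAY P k w a y * g a y := by
  simp only [avg, margAY, Finset.sum_mul]
  rw [Finset.sum_comm]
  refine Finset.sum_congr rfl fun a _ => ?_
  rw [Finset.sum_comm]

theorem sum_margAY (hw : ∀ x a, ∑ y, w x a y = 1) (a : A) :
    ∑ y, margAY P k w a y = margA P k a := by
  simp only [margAY, margA]
  rw [Finset.sum_comm]
  refine Finset.sum_congr rfl fun x _ => ?_
  rw [← Finset.mul_sum, hw, mul_one]

theorem sum_margA (hk : ∀ x, ∑ a, k x a = 1) : ∑ a, margA P k a = ∑ x, P x := by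
  simp only [margA]
  rw [Finset.sum_comm]
  refine Finset.sum_congr rfl fun x _ => ?_
  rw [← Finset.mul_sum, hk, mul_one]

theorem margA_nonneg (hP : ∀ x, 0 ≤ P x) (hk : ∀ x a, 0 ≤ k x a) (a : A) : 0 ≤ margA P k a :=
  Finset.sum_nonneg fun x _ => mul_nonneg (hP x) (hk x a)

theorem margAY_nonneg (hP : ∀ x, 0 ≤ P x) (hk : ∀ x a, 0 ≤ k x a) (hw : ∀ x a y, 0 ≤ w x a y)
    (a : A) (y : Y) : 0 ≤ margAY P k w a y :=
  Finset.sum_nonneg fun x _ => mul_nonneg (mul_nonneg (hP x) (hk x a)) (hw x a y)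

theorem le_margA (hP : ∀ x, 0 ≤ P x) (hk : ∀ x a, 0 ≤ k x a) (x : X) (a : A) :
    P x * k x a ≤ margA P k a :=
  Finset.single_le_sum (f := fun x => P x * k x a) (fun x _ => mul_nonneg (hP x) (hk x a))
    (Finset.mem_univ x)

theorem le_margAY (hP : ∀ x, 0 ≤ P x) (hk : ∀ x a, 0 ≤ k x a) (hw : ∀ x a y, 0 ≤ w x a y)
    (x : X) (a : A) (y : Y) : P x * k x a * w x a y ≤ margAY P k w a y :=
  Finset.single_le_sum (f := fun x => P x * k x a * w x a y)
    (fun x _ => mul_nonneg (mul_nonneg (hP x) (hk x a)) (hw x a y)) (Finset.mem_univ x)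

theorem margAY_le_margA (hP : ∀ x, 0 ≤ P x) (hk : ∀ x a, 0 ≤ k x a)
    (hw : ∀ x a, w x a ∈ stdSimplex ℝ Y) (a : A) (y : Y) : margAY P k w a y ≤ margA P k a := by
  rw [← sum_margAY (fun x a => (hw x a).2)]
  exact Finset.single_le_sum (f := fun y => margAY P k w a y)
    (fun y _ => margAY_nonneg hP hk (fun x a => (hw x a).1) a y) (Finset.mem_univ y)

/-- `I(X; Y | A)` is minus the supremum over test channels: one inequality. -/
theorem avg_le_rateX (hP : P ∈ stdSimplex ℝ X) (hk : ∀ x, k x ∈ stdSimplex ℝ A)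
    (hw : ∀ x a, w x a ∈ stdSimplex ℝ Y) {Q : A → Y → ℝ} (hQ : ∀ a y, 0 ≤ Q a y)
    (hQs : ∀ a, ∑ y, Q a y ≤ 1) (hQp : ∀ a y, 0 < margAY P k w a y → 0 < Q a y) :
    avg P k w (fun x a y => -Real.log (P x) - Real.log (w x a y) + Real.log (Q a y)) ≤
      rateX P k w := by
  rw [rateX, avg_add, avg_add, add_le_add_iff_left, avg_snd, avg_snd]
  have hk0 := fun x a => (hk x).1 a
  have hw0 := fun x a y => (hw x a).1 y
  have hm := margA_nonneg hP.1 hk0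
  have hmy := margAY_nonneg hP.1 hk0 hw0
  have hpos : ∀ a y, 0 < margAY P k w a y → 0 < margA P k a := fun a y h =>
    h.trans_le (margAY_le_margA hP.1 hk0 hw a y)
  -- The Gibbs inequality on pairs (a, y), comparing P_{A,Y} with P_A Q.
  have hg := sum_mul_log_le (Ω := A × Y) (p := fun ω => margAY P k w ω.1 ω.2)
    (q := fun ω => margA P k ω.1 * Q ω.1 ω.2)
    ⟨fun ω => hmy _ _, by
      rw [Fintype.sum_prod_type]
      simp only [sum_margAY (fun x a => (hw x a).2)]
      rw [sum_margA (fun x => (hk x).2), hP.2]⟩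
    (by
      rw [Fintype.sum_prod_type]
      simp only [← Finset.mul_sum]
      rw [← hP.2, ← sum_margA (fun x => (hk x).2)]
      exact Finset.sum_le_sum fun a _ => mul_le_of_le_one_right (hm a) (hQs a))
    (fun ω => mul_nonneg (hm _) (hQ _ _))
    (fun ω h => mul_pos (hpos _ _ h) (hQp _ _ h))
  rw [Fintype.sum_prod_type, Fintype.sum_prod_type] at hg
  have key : ∀ a y, margAY P k w a y * Real.log (Q a y) -
      margAY P k w a y * Real.log (margAY P k w a y / margA P k a) =
      margAY P k w a y * Real.log (margA P k a * Q a y) -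
      margAY P k w a y * Real.log (margAY P k w a y) := by
    intro a y
    rcases (hmy a y).eq_or_lt with h0 | h0
    · simp [← h0]
    rw [Real.log_div h0.ne' (hpos a y h0).ne', Real.log_mul (hpos a y h0).ne' (hQp a y h0).ne']
    ring
  have h2 : ∑ a, ∑ y, (margAY P k w a y * Real.log (Q a y) -
      margAY P k w a y * Real.log (margAY P k w a y / margA P k a)) ≤ 0 := by
    simp only [key, Finset.sum_sub_distrib]
    linarith
  simp only [Finset.sum_sub_distrib] at h2
  linarith

/-- Made for continuity in the kernel: `Real.negMulLog` is continuous at 0, whereas the logarithm of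
a quotient of marginals is not. -/
theorem rateX_eq (hP : P ∈ stdSimplex ℝ X) (hk : ∀ x, k x ∈ stdSimplex ℝ A)
    (hw : ∀ x a, w x a ∈ stdSimplex ℝ Y) :
    rateX P k w = avg P k w (fun x a y => -Real.log (P x) - Real.log (w x a y)) +
      (∑ a, Real.negMulLog (margA P k a) - ∑ a, ∑ y, Real.negMulLog (margAY P k w a y)) := by
  rw [rateX, avg_add, avg_snd, ← Finset.sum_sub_distrib]
  congr 1
  refine Finset.sum_congr rfl fun a _ => ?_
  have hk0 := fun x a => (hk x).1 a
  have hmy := margAY_nonneg hP.1 hk0 (fun x a y => (hw x a).1 y)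
  have : Real.negMulLog (margA P k a) =
      ∑ y, -(margAY P k w a y) * Real.log (margA P k a) := by
    rw [Real.negMulLog, ← sum_margAY (fun x a => (hw x a).2), ← Finset.sum_mul,
      Finset.sum_neg_distrib]
  rw [this, ← Finset.sum_sub_distrib]
  refine Finset.sum_congr rfl fun y _ => ?_
  rcases (hmy a y).eq_or_lt with h0 | h0
  · simp [← h0]
  rw [Real.log_div h0.ne' (h0.trans_le (margAY_le_margA hP.1 hk0 hw a y)).ne', Real.negMulLog]
  ring

/-! ### Convexity and closedness of the region. -/

theorem margAY_mix (k₁ k₂ : X → A → ℝ) (s t : ℝ) (a : A) (y : Y) :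
    margAY P (s • k₁ + t • k₂) w a y = s * margAY P k₁ w a y + t * margAY P k₂ w a y := by
  simp only [margAY, Pi.add_apply, Pi.smul_apply, smul_eq_mul, Finset.mul_sum,
    ← Finset.sum_add_distrib]
  exact Finset.sum_congr rfl fun x _ => by ring

theorem avg_mix (k₁ k₂ : X → A → ℝ) (s t : ℝ) (φ : X → A → Y → ℝ) :
    avg P (s • k₁ + t • k₂) w φ = s * avg P k₁ w φ + t * avg P k₂ w φ := by
  simp only [avg, Pi.add_apply, Pi.smul_apply, smul_eq_mul, Finset.mul_sum,
    ← Finset.sum_add_distrib]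
  exact Finset.sum_congr rfl fun x _ => Finset.sum_congr rfl fun a _ =>
    Finset.sum_congr rfl fun y _ => by ring

theorem mix_mem {k₁ k₂ : X → A → ℝ} (h₁ : ∀ x, k₁ x ∈ stdSimplex ℝ A)
    (h₂ : ∀ x, k₂ x ∈ stdSimplex ℝ A) {s t : ℝ} (hs : 0 ≤ s) (ht : 0 ≤ t) (hst : s + t = 1)
    (x : X) : (s • k₁ + t • k₂) x ∈ stdSimplex ℝ A :=
  convex_stdSimplex ℝ A (h₁ x) (h₂ x) hs ht hst

/-- Let Q be the conditional law of Y given A under the mixed kernel. With this test channel the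
rate of the mixture is a linear functional of the kernel, and at each endpoint that functional is at
most the rate. -/
theorem rateX_mix_le (hP : P ∈ stdSimplex ℝ X) (hw : ∀ x a, w x a ∈ stdSimplex ℝ Y)
    {k₁ k₂ : X → A → ℝ} (h₁ : ∀ x, k₁ x ∈ stdSimplex ℝ A) (h₂ : ∀ x, k₂ x ∈ stdSimplex ℝ A)
    {s t : ℝ} (hs : 0 ≤ s) (ht : 0 ≤ t) (hst : s + t = 1) :
    rateX P (s • k₁ + t • k₂) w ≤ s * rateX P k₁ w + t * rateX P k₂ w := by
  -- Both weights must be positive for Q to be positive wherever the marginals of `k₁` and `k₂` are.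
  rcases hs.eq_or_lt with hs0 | hs0
  · obtain rfl : t = 1 := by linarith
    simp [← hs0]
  rcases ht.eq_or_lt with ht0 | ht0
  · obtain rfl : s = 1 := by linarith
    simp [← ht0]
  have hk := mix_mem h₁ h₂ hs ht hst
  set k := s • k₁ + t • k₂ with hkdef
  have hw0 := fun x a y => (hw x a).1 y
  have hm := margA_nonneg hP.1 (fun x a => (hk x).1 a)
  have hmy := margAY_nonneg hP.1 (fun x a => (hk x).1 a) hw0
  have hmy₁ := margAY_nonneg hP.1 (fun x a => (h₁ x).1 a) hw0
  have hmy₂ := margAY_nonneg hP.1 (fun x a => (h₂ x).1 a) hw0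
  have hle := margAY_le_margA hP.1 (fun x a => (hk x).1 a) hw
  have hQ0 : ∀ a y, 0 ≤ margAY P k w a y / margA P k a := fun a y => div_nonneg (hmy a y) (hm a)
  have hQs : ∀ a, ∑ y, margAY P k w a y / margA P k a ≤ 1 := fun a => by
    rw [← Finset.sum_div, sum_margAY (fun x a => (hw x a).2)]
    exact div_self_le_one _
  have hQp : ∀ a y, 0 < margAY P k w a y → 0 < margAY P k w a y / margA P k a :=
    fun a y h => div_pos h (h.trans_le (hle a y))
  have hmix := margAY_mix (P := P) (w := w) k₁ k₂ s t
  rw [← hkdef] at hmix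
  have e₁ := avg_le_rateX hP h₁ hw hQ0 hQs fun a y h => hQp a y (by
    rw [hmix]; have := mul_pos hs0 h; have := mul_nonneg ht (hmy₂ a y); linarith)
  have e₂ := avg_le_rateX hP h₂ hw hQ0 hQs fun a y h => hQp a y (by
    rw [hmix]; have := mul_pos ht0 h; have := mul_nonneg hs (hmy₁ a y); linarith)
  rw [rateX, hkdef, avg_mix, ← hkdef]
  exact add_le_add (mul_le_mul_of_nonneg_left e₁ hs) (mul_le_mul_of_nonneg_left e₂ ht)

theorem convex_weightRegion (hP : P ∈ stdSimplex ℝ X) (hw : ∀ x a, w x a ∈ stdSimplex ℝ Y)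
    (Λ : A → ℝ) : Convex ℝ (weightRegion P w Λ) := by
  rintro r ⟨k₁, h₁, hX₁, hY₁, hS₁, hc₁⟩ r' ⟨k₂, h₂, hX₂, hY₂, hS₂, hc₂⟩ s t hs ht hst
  refine ⟨s • k₁ + t • k₂, mix_mem h₁ h₂ hs ht hst, ?_, ?_, ?_, ?_⟩
  · have := rateX_mix_le hP hw h₁ h₂ hs ht hst
    have e₁ := mul_le_mul_of_nonneg_left hX₁ hs
    have e₂ := mul_le_mul_of_nonneg_left hX₂ ht
    simp only [Prod.fst_add, Prod.smul_fst, smul_eq_mul]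
    linarith
  · have e₁ := mul_le_mul_of_nonneg_left hY₁ hs
    have e₂ := mul_le_mul_of_nonneg_left hY₂ ht
    rw [rateY, avg_mix]
    simp only [rateY] at e₁ e₂
    simp only [Prod.snd_add, Prod.smul_snd, Prod.fst_add, Prod.smul_fst, smul_eq_mul]
    linarith
  · have e₁ := mul_le_mul_of_nonneg_left hS₁ hs
    have e₂ := mul_le_mul_of_nonneg_left hS₂ ht
    rw [rateSum, avg_mix]
    simp only [rateSum] at e₁ e₂
    simp only [Prod.snd_add, Prod.smul_snd, Prod.fst_add, Prod.smul_fst, smul_eq_mul]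
    linarith
  · have e₁ := mul_le_mul_of_nonneg_left hc₁ hs
    have e₂ := mul_le_mul_of_nonneg_left hc₂ ht
    simp only [Prod.snd_add, Prod.smul_snd, smul_eq_mul]
    refine le_trans (le_of_eq ?_) (add_le_add e₁ e₂)
    simp only [Pi.add_apply, Pi.smul_apply, smul_eq_mul, Finset.mul_sum,
      ← Finset.sum_add_distrib]
    exact Finset.sum_congr rfl fun x _ => Finset.sum_congr rfl fun a _ => by ring

theorem continuous_avg (φ : X → A → Y → ℝ) :
    Continuous fun k : X → A → ℝ => avg P k w φ := by
  refine continuous_finsetSum _ fun x _ => continuous_finsetSum _ fun a _ =>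
    continuous_finsetSum _ fun y _ => ?_
  have : Continuous fun k : X → A → ℝ => k x a := by fun_prop
  exact ((continuous_const.mul this).mul continuous_const).mul continuous_const

theorem continuous_margA (a : A) : Continuous fun k : X → A → ℝ => margA P k a :=
  continuous_finsetSum _ fun x _ => continuous_const.mul (by fun_prop)

theorem continuous_margAY (a : A) (y : Y) : Continuous fun k : X → A → ℝ => margAY P k w a y :=
  continuous_finsetSum _ fun x _ => (continuous_const.mul (by fun_prop)).mul continuous_const

theorem isClosed_weightRegion (hP : P ∈ stdSimplex ℝ X) (hw : ∀ x a, w x a ∈ stdSimplex ℝ Y)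
    (Λ : A → ℝ) : IsClosed (weightRegion P w Λ) := by
  set S : Set (X → A → ℝ) := Set.univ.pi fun _ => stdSimplex ℝ A with hS
  have hSc : IsCompact S := isCompact_univ_pi fun _ => isCompact_stdSimplex ℝ A
  have : CompactSpace S := isCompact_iff_compactSpace.1 hSc
  have hmem : ∀ q : S, ∀ x, q.1 x ∈ stdSimplex ℝ A := fun q x => q.2 x (Set.mem_univ x)
  have hval : Continuous fun q : S × (ℝ × ℝ × ℝ) => q.1.1 :=
    continuous_subtype_val.comp continuous_fst
  have hcX : Continuous fun q : S => rateX P q.1 w := by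
    rw [funext fun q : S => rateX_eq hP (hmem q) hw]
    refine ((continuous_avg _).comp continuous_subtype_val).add (Continuous.sub ?_ ?_)
    · exact continuous_finsetSum _ fun a _ => Real.continuous_negMulLog.comp
        ((continuous_margA a).comp continuous_subtype_val)
    · exact continuous_finsetSum _ fun a _ => continuous_finsetSum _ fun y _ =>
        Real.continuous_negMulLog.comp ((continuous_margAY a y).comp continuous_subtype_val)
  have hcc : Continuous fun k : X → A → ℝ => ∑ x, ∑ a, P x * k x a * Λ a :=
    continuous_finsetSum _ fun x _ => continuous_finsetSum _ fun a _ =>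
      (continuous_const.mul (by fun_prop)).mul continuous_const
  have h1 : Continuous fun q : S × (ℝ × ℝ × ℝ) => q.2.1 := continuous_fst.comp continuous_snd
  have h2 : Continuous fun q : S × (ℝ × ℝ × ℝ) => q.2.2.1 :=
    continuous_fst.comp (continuous_snd.comp continuous_snd)
  have h3 : Continuous fun q : S × (ℝ × ℝ × ℝ) => q.2.2.2 :=
    continuous_snd.comp (continuous_snd.comp continuous_snd)
  have hT : IsClosed {q : S × (ℝ × ℝ × ℝ) | rateX P q.1 w ≤ q.2.1 * Real.log 2 ∧
      rateY P q.1 w ≤ q.2.2.1 * Real.log 2 ∧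
      rateSum P q.1 w ≤ (q.2.1 + q.2.2.1) * Real.log 2 ∧
      ∑ x, ∑ a, P x * q.1.1 x a * Λ a ≤ q.2.2.2} :=
    (isClosed_le (hcX.comp continuous_fst) (h1.mul continuous_const)).inter
      ((isClosed_le ((continuous_avg _).comp hval) (h2.mul continuous_const)).inter
      ((isClosed_le ((continuous_avg _).comp hval) ((h1.add h2).mul continuous_const)).inter
      (isClosed_le (hcc.comp hval) h3)))
  -- Existence of a kernel is a projection along the compact space of kernels, and such projections
  -- are closed maps.
  have := isClosedMap_snd_of_compactSpace _ hT
  convert this using 1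
  ext r
  constructor
  · rintro ⟨k, hk, h⟩
    exact ⟨(⟨k, fun x _ => hk x⟩, r), h, rfl⟩
  · rintro ⟨⟨k, r⟩, h, rfl⟩
    exact ⟨k.1, hmem k, h⟩

end Rates

/-! Comparison with the information measures of probability mass functions. -/

open Classical in
theorem prob_eq_sum {Ω α : Type*} [Fintype Ω] (q : PMF Ω) (U : Ω → α) (u : α) :
    prob q U u = ∑ ω, if U ω = u then (q ω).toReal else 0 := by
  rw [prob, PMF.map_apply, tsum_fintype, ENNReal.toReal_sum]
  · refine Finset.sum_congr rfl fun ω _ => ?_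
    by_cases h : U ω = u
    · simp [h]
    · simp [h, Ne.symm h]
  · intro ω _
    split_ifs
    · exact q.apply_ne_top ω
    · simp

theorem toReal_mem_stdSimplex {Ω : Type*} [Fintype Ω] (q : PMF Ω) :
    (fun ω => (q ω).toReal) ∈ stdSimplex ℝ Ω := by
  refine ⟨fun ω => ENNReal.toReal_nonneg, ?_⟩
  rw [← ENNReal.toReal_sum fun ω _ => q.apply_ne_top ω, ← tsum_fintype (L := .unconditional Ω),
    q.tsum_coe]
  simp

theorem exists_pmf_of_mem_stdSimplex {Ω : Type*} [Fintype Ω] {p : Ω → ℝ}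
    (hp : p ∈ stdSimplex ℝ Ω) : ∃ q : PMF Ω, ∀ ω, (q ω).toReal = p ω := by
  refine ⟨PMF.ofFintype (fun ω => ENNReal.ofReal (p ω)) ?_, fun ω => ?_⟩
  · rw [← ENNReal.ofReal_sum_of_nonneg fun ω _ => hp.1 ω, hp.2, ENNReal.ofReal_one]
  · simp [ENNReal.toReal_ofReal (hp.1 ω)]

section Bridge

set_option linter.unusedSectionVars false

variable {X A Y : Type*} [Fintype X] [Fintype A] [Fintype Y]
  (P : PMF X) (K : X → PMF A) (W : X → A → PMF Y)

theorem jointLaw_apply (x : X) (a : A) (y : Y) :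
    (jointLaw P K W (x, a, y)).toReal = (P x).toReal * (K x a).toReal * (W x a y).toReal := by
  classical
  have : jointLaw P K W (x, a, y) = P x * (K x a * W x a y) := by
    rw [jointLaw, PMF.bind_apply, tsum_eq_single x]
    · congr 1
      rw [PMF.bind_apply, tsum_eq_single a]
      · congr 1
        rw [PMF.map_apply, tsum_eq_single y]
        · simp
        · intro y' hy'
          simp [Ne.symm hy']
      · intro a' ha'
        simp [PMF.map_apply, Ne.symm ha']
    · intro x' hx'
      simp [PMF.bind_apply, PMF.map_apply, Ne.symm hx']
  rw [this, ENNReal.toReal_mul, ENNReal.toReal_mul, mul_assoc]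

open Classical in
theorem prob_jointLaw {α : Type*} (U : X × A × Y → α) (u : α) :
    prob (jointLaw P K W) U u = ∑ x, ∑ a, ∑ y, if U (x, a, y) = u then
      (P x).toReal * (K x a).toReal * (W x a y).toReal else 0 := by
  rw [prob_eq_sum, Fintype.sum_prod_type]
  refine Finset.sum_congr rfl fun x _ => ?_
  rw [Fintype.sum_prod_type]
  simp only [jointLaw_apply]

theorem prob_rvA (a : A) : prob (jointLaw P K W) rvA a =
    margA (fun x => (P x).toReal) (fun x a => (K x a).toReal) a := by
  classical
  rw [prob_jointLaw, margA]
  refine Finset.sum_congr rfl fun x _ => ?_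
  simp only [rvA]
  rw [Finset.sum_eq_single a]
  · simp [← Finset.mul_sum, (toReal_mem_stdSimplex (W x a)).2]
  · intro b _ hb
    simp [hb]
  · simp

theorem prob_rvX (x : X) : prob (jointLaw P K W) rvX x = (P x).toReal := by
  classical
  rw [prob_jointLaw]
  simp only [rvX]
  rw [Finset.sum_eq_single x]
  · simp [← Finset.mul_sum, (toReal_mem_stdSimplex (W x _)).2, (toReal_mem_stdSimplex (K x)).2]
  · intro b _ hb
    simp [hb]
  · simp

theorem prob_rvX_rvA (x : X) (a : A) :
    prob (jointLaw P K W) (fun ω => (rvX ω, rvA ω)) (x, a) =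
      (P x).toReal * (K x a).toReal := by
  classical
  rw [prob_jointLaw]
  simp only [rvX, rvA, Prod.mk.injEq]
  rw [Finset.sum_eq_single x, Finset.sum_eq_single a]
  · simp [← Finset.mul_sum, (toReal_mem_stdSimplex (W x a)).2]
  · intro b _ hb
    simp [hb]
  · simp
  · intro b _ hb
    simp [hb]
  · simp

theorem prob_rvPair_rvY_rvA (a : A) (y : Y) :
    prob (jointLaw P K W) (rvPair rvY rvA) (y, a) =
      margAY (fun x => (P x).toReal) (fun x a => (K x a).toReal)
        (fun x a y => (W x a y).toReal) a y := by
  classical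
  rw [prob_jointLaw, margAY]
  refine Finset.sum_congr rfl fun x _ => ?_
  simp only [rvPair, rvY, rvA, Prod.mk.injEq]
  rw [Finset.sum_eq_single a, Finset.sum_eq_single y]
  · simp
  · intro b _ hb
    simp [hb]
  · simp
  · intro b _ hb
    simp [hb]
  · simp

/-- Covers all the nestings of the three coordinates that occur in the conditional entropies. -/
theorem prob_triple {α : Type*} {U : X × A × Y → α} {u : α} {x : X} {a : A} {y : Y}
    (h : ∀ ω, U ω = u ↔ ω = (x, a, y)) : prob (jointLaw P K W) U u =
      (P x).toReal * (K x a).toReal * (W x a y).toReal := by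
  classical
  rw [prob_eq_sum, Finset.sum_eq_single (x, a, y)]
  · rw [if_pos ((h _).2 rfl), jointLaw_apply]
  · intro ω _ hω
    rw [if_neg fun hU => hω ((h ω).1 hU)]
  · simp

theorem condEntropy_rvX_mul_log :
    condEntropy (jointLaw P K W) rvX (rvPair rvY rvA) * Real.log 2 =
      avg (fun x => (P x).toReal) (fun x a => (K x a).toReal) (fun x a y => (W x a y).toReal)
        fun x a y => -Real.log ((P x).toReal * (K x a).toReal * (W x a y).toReal /
          margAY (fun x => (P x).toReal) (fun x a => (K x a).toReal)
            (fun x a y => (W x a y).toReal) a y) := by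
  have h2 : Real.log 2 ≠ 0 := (Real.log_pos one_lt_two).ne'
  rw [avg_neg, condEntropy, neg_mul, Finset.sum_mul, avg]
  congr 1
  refine Finset.sum_congr rfl fun x _ => ?_
  rw [Fintype.sum_prod_type, Finset.sum_comm, Finset.sum_mul]
  refine Finset.sum_congr rfl fun a _ => ?_
  rw [Finset.sum_mul]
  refine Finset.sum_congr rfl fun y _ => ?_
  rw [prob_triple P K W (x := x) (a := a) (y := y)
    (by simp only [rvX, rvPair, rvY, rvA, Prod.ext_iff]; tauto), prob_rvPair_rvY_rvA, Real.logb]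
  field_simp

theorem condEntropy_rvY_mul_log :
    condEntropy (jointLaw P K W) rvY (rvPair rvX rvA) * Real.log 2 =
      avg (fun x => (P x).toReal) (fun x a => (K x a).toReal) (fun x a y => (W x a y).toReal)
        fun x a y => -Real.log ((P x).toReal * (K x a).toReal * (W x a y).toReal /
          ((P x).toReal * (K x a).toReal)) := by
  have h2 : Real.log 2 ≠ 0 := (Real.log_pos one_lt_two).ne'
  rw [avg_neg, condEntropy, neg_mul, Finset.sum_comm, Fintype.sum_prod_type, Finset.sum_mul, avg]
  congr 1
  refine Finset.sum_congr rfl fun x _ => ?_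
  rw [Finset.sum_mul]
  refine Finset.sum_congr rfl fun a _ => ?_
  rw [Finset.sum_mul]
  refine Finset.sum_congr rfl fun y _ => ?_
  have hXA : prob (jointLaw P K W) (rvPair rvX rvA) (x, a) = (P x).toReal * (K x a).toReal :=
    prob_rvX_rvA P K W x a
  rw [prob_triple P K W (x := x) (a := a) (y := y)
    (by simp only [rvX, rvPair, rvY, rvA, Prod.ext_iff]; tauto), hXA, Real.logb]
  field_simp

theorem condEntropy_rvPair_mul_log :
    condEntropy (jointLaw P K W) (rvPair rvX rvY) rvA * Real.log 2 =
      avg (fun x => (P x).toReal) (fun x a => (K x a).toReal) (fun x a y => (W x a y).toReal)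
        fun x a y => -Real.log ((P x).toReal * (K x a).toReal * (W x a y).toReal /
          margA (fun x => (P x).toReal) (fun x a => (K x a).toReal) a) := by
  have h2 : Real.log 2 ≠ 0 := (Real.log_pos one_lt_two).ne'
  rw [avg_neg, condEntropy, neg_mul, Fintype.sum_prod_type, Finset.sum_mul, avg]
  congr 1
  refine Finset.sum_congr rfl fun x _ => ?_
  rw [Finset.sum_comm, Finset.sum_mul]
  refine Finset.sum_congr rfl fun a _ => ?_
  rw [Finset.sum_mul]
  refine Finset.sum_congr rfl fun y _ => ?_
  rw [prob_triple P K W (x := x) (a := a) (y := y)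
    (by simp only [rvX, rvPair, rvY, rvA, Prod.ext_iff]; tauto), prob_rvA, Real.logb]
  field_simp

theorem mutualInfo_mul_log :
    mutualInfo (jointLaw P K W) rvX rvA * Real.log 2 =
      avg (fun x => (P x).toReal) (fun x a => (K x a).toReal) (fun x a y => (W x a y).toReal)
        fun x a _ => Real.log ((P x).toReal * (K x a).toReal /
          ((P x).toReal * margA (fun x => (P x).toReal) (fun x a => (K x a).toReal) a)) := by
  have h2 : Real.log 2 ≠ 0 := (Real.log_pos one_lt_two).ne'
  rw [avg_fst_snd (w := fun x a y => (W x a y).toReal)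
    (fun x a => (toReal_mem_stdSimplex (W x a)).2), mutualInfo, Finset.sum_mul]
  refine Finset.sum_congr rfl fun x _ => ?_
  rw [Finset.sum_mul]
  refine Finset.sum_congr rfl fun a _ => ?_
  rw [prob_rvX_rvA, prob_rvX, prob_rvA, Real.logb]
  field_simp

/-- On the support, adding I(X;A) cancels log P(a|x) in both conditional entropies. The kernel then
survives inside logarithms only through marginals, and in the sum bound not at all. -/
theorem singleLetterRegion_eq_weightRegion (Λ : A → ℝ) :
    singleLetterRegion P W Λ =
      weightRegion (fun x => (P x).toReal) (fun x a y => (W x a y).toReal) Λ := by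
  have hlog : 0 < Real.log 2 := Real.log_pos one_lt_two
  have hP := toReal_mem_stdSimplex P
  have hw := fun x a => toReal_mem_stdSimplex (W x a)
  have key : ∀ (K : X → PMF A) (r : ℝ × ℝ × ℝ),
      (condEntropy (jointLaw P K W) rvX (rvPair rvY rvA)
        + mutualInfo (jointLaw P K W) rvX rvA ≤ r.1 ∧
      condEntropy (jointLaw P K W) rvY (rvPair rvX rvA) ≤ r.2.1 ∧
      condEntropy (jointLaw P K W) (rvPair rvX rvY) rvA
        + mutualInfo (jointLaw P K W) rvX rvA ≤ r.1 + r.2.1 ∧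
      ∑ a, prob (jointLaw P K W) rvA a * Λ a ≤ r.2.2) ↔
      (rateX (fun x => (P x).toReal) (fun x a => (K x a).toReal)
          (fun x a y => (W x a y).toReal) ≤ r.1 * Real.log 2 ∧
        rateY (fun x => (P x).toReal) (fun x a => (K x a).toReal)
          (fun x a y => (W x a y).toReal) ≤ r.2.1 * Real.log 2 ∧
        rateSum (fun x => (P x).toReal) (fun x a => (K x a).toReal)
          (fun x a y => (W x a y).toReal) ≤ (r.1 + r.2.1) * Real.log 2 ∧
        ∑ x, ∑ a, (P x).toReal * (K x a).toReal * Λ a ≤ r.2.2) := by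
    intro K r
    have hk := fun x => toReal_mem_stdSimplex (K x)
    have hm := le_margA hP.1 fun x a => (hk x).1 a
    have hmy := le_margAY hP.1 (fun x a => (hk x).1 a) fun x a y => (hw x a).1 y
    have eX : (condEntropy (jointLaw P K W) rvX (rvPair rvY rvA)
        + mutualInfo (jointLaw P K W) rvX rvA) * Real.log 2 =
        rateX (fun x => (P x).toReal) (fun x a => (K x a).toReal)
          (fun x a y => (W x a y).toReal) := by
      rw [add_mul, condEntropy_rvX_mul_log, mutualInfo_mul_log, ← avg_add]
      refine avg_congr hP.1 (fun x a => (hk x).1 a) (fun x a y => (hw x a).1 y) ?_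
      intro x a y h1 h2 h3
      have h4 := (mul_pos h1 h2).trans_le (hm x a)
      have h5 := (mul_pos (mul_pos h1 h2) h3).trans_le (hmy x a y)
      rw [Real.log_div (by positivity) h5.ne', Real.log_div (by positivity) (by positivity),
        Real.log_div h5.ne' h4.ne', Real.log_mul (by positivity) h3.ne',
        Real.log_mul h1.ne' h4.ne', Real.log_mul h1.ne' h2.ne']
      ring
    have eY : condEntropy (jointLaw P K W) rvY (rvPair rvX rvA) * Real.log 2 =
        rateY (fun x => (P x).toReal) (fun x a => (K x a).toReal)
          (fun x a y => (W x a y).toReal) := by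
      rw [condEntropy_rvY_mul_log]
      refine avg_congr hP.1 (fun x a => (hk x).1 a) (fun x a y => (hw x a).1 y) ?_
      intro x a y h1 h2 h3
      rw [mul_div_cancel_left₀ _ (mul_pos h1 h2).ne']
    have eS : (condEntropy (jointLaw P K W) (rvPair rvX rvY) rvA
        + mutualInfo (jointLaw P K W) rvX rvA) * Real.log 2 =
        rateSum (fun x => (P x).toReal) (fun x a => (K x a).toReal)
          (fun x a y => (W x a y).toReal) := by
      rw [add_mul, condEntropy_rvPair_mul_log, mutualInfo_mul_log, ← avg_add]
      refine avg_congr hP.1 (fun x a => (hk x).1 a) (fun x a y => (hw x a).1 y) ?_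
      intro x a y h1 h2 h3
      have h4 := (mul_pos h1 h2).trans_le (hm x a)
      rw [Real.log_div (by positivity) h4.ne', Real.log_div (by positivity) (by positivity),
        Real.log_mul (by positivity) h3.ne', Real.log_mul h1.ne' h4.ne',
        Real.log_mul h1.ne' h2.ne']
      ring
    have eC : ∑ a, prob (jointLaw P K W) rvA a * Λ a =
        ∑ x, ∑ a, (P x).toReal * (K x a).toReal * Λ a := by
      rw [Finset.sum_comm]
      refine Finset.sum_congr rfl fun a _ => ?_
      rw [prob_rvA, margA, Finset.sum_mul]
    rw [← eX, ← eY, ← eS, eC, mul_le_mul_iff_left₀ hlog, mul_le_mul_iff_left₀ hlog,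
      mul_le_mul_iff_left₀ hlog]
  ext r
  constructor
  · rintro ⟨K, h⟩
    exact ⟨fun x a => (K x a).toReal, fun x => toReal_mem_stdSimplex (K x), (key K r).1 h⟩
  · rintro ⟨k, hk, h⟩
    choose K hK using fun x => exists_pmf_of_mem_stdSimplex (hk x)
    obtain rfl : (fun x a => (K x a).toReal) = k := funext fun x => funext fun a => hK x a
    exact ⟨K, (key K r).2 h⟩

end Bridge

/-! The converse. -/

open Classical in
theorem sum_ite_le_sum_of_injective {α β : Type*} [Fintype α] [Fintype β] {C : α → Prop}
    {e : α → β} (he : ∀ a a', C a → C a' → e a = e a' → a = a') {g : β → ℝ}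
    (hg : ∀ b, 0 ≤ g b) : ∑ a, (if C a then g (e a) else 0) ≤ ∑ b, g b := by
  rw [← Finset.sum_filter, ← Finset.sum_image (s := Finset.univ.filter C) (g := e) (f := g)]
  · exact Finset.sum_le_univ_sum_of_nonneg hg
  · intro a ha a' ha' h
    exact he a a' (by simpa using ha) (by simpa using ha') h

/-! ### Mass of the correctly decoded pairs. -/

section CorrectDecoding

set_option linter.unusedSectionVars false

variable {α β S T : Type*} [Fintype α] [Fintype β] [Fintype S] [Fintype T]
  {e : α → S} {f : β → T} {g : S → T → α × β} {C : α × β → Prop}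

open Classical in
-- For fixed `b`, each first message belongs to at most one correctly decoded `a`, and `F` sees `a`
-- only through that message. Summing over `b` leaves mass at most 1 per message.
theorem sum_correct_le_card_fst (hC : ∀ ω, C ω → ω = g (e ω.1) (f ω.2)) {F : S → β → ℝ}
    (hF : ∀ s b, 0 ≤ F s b) (hFs : ∀ s, ∑ b, F s b ≤ 1) :
    ∑ ω : α × β, (if C ω then F (e ω.1) ω.2 else 0) ≤ Fintype.card S := by
  rw [Fintype.sum_prod_type_right]
  have h : ∀ b, ∑ a, (if C (a, b) then F (e a) b else 0) ≤ ∑ s, F s b := by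
    intro b
    refine sum_ite_le_sum_of_injective (C := fun a => C (a, b)) (e := e)
      (g := fun s => F s b) ?_ fun s => hF s b
    intro a a' h1 h2 h
    have h1 := hC _ h1
    have h2 := hC _ h2
    simp only [h] at h1 h2
    exact congrArg Prod.fst (h1.trans h2.symm)
  refine (Finset.sum_le_sum fun b _ => h b).trans ?_
  rw [Finset.sum_comm]
  exact (Finset.sum_le_sum fun s _ => hFs s).trans (by simp)

open Classical in
-- For fixed `a`, each second message belongs to at most one correctly decoded `b`.
theorem sum_correct_le_card_snd (hC : ∀ ω, C ω → ω = g (e ω.1) (f ω.2)) {F : α → ℝ}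
    (hF : ∀ a, 0 ≤ F a) (hFs : ∑ a, F a ≤ 1) :
    ∑ ω : α × β, (if C ω then F ω.1 else 0) ≤ Fintype.card T := by
  rw [Fintype.sum_prod_type]
  have h : ∀ a, ∑ b, (if C (a, b) then F a else 0) ≤ ∑ _t : T, F a := by
    intro a
    refine sum_ite_le_sum_of_injective (C := fun b => C (a, b)) (e := f)
      (g := fun _ => F a) ?_ fun _ => hF a
    intro b b' h1 h2 h
    have h1 := hC _ h1
    have h2 := hC _ h2
    simp only [h] at h1 h2
    exact congrArg Prod.snd (h1.trans h2.symm)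
  refine (Finset.sum_le_sum fun a _ => h a).trans ?_
  rw [Finset.sum_comm]
  exact (Finset.sum_le_sum fun t _ => hFs).trans (by simp)

open Classical in
theorem sum_correct_le_card (hC : ∀ ω, C ω → ω = g (e ω.1) (f ω.2)) :
    ∑ ω : α × β, (if C ω then (1 : ℝ) else 0) ≤ (Fintype.card S : ℝ) * Fintype.card T := by
  refine (sum_ite_le_sum_of_injective (C := C)
    (e := fun ω => (e ω.1, f ω.2)) (g := fun _ => (1 : ℝ)) (fun ω ω' h1 h2 h => ?_)
    fun _ => zero_le_one).trans (by simp)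
  simp only [Prod.mk.injEq] at h
  rw [hC _ h1, hC _ h2, h.1, h.2]

end CorrectDecoding

/-! ### Single-letterization and the bound for one code. -/

section Converse

set_option linter.unusedSectionVars false

variable {X A Y : Type*} [Fintype X] [Fintype A] [Fintype Y]

/-- Averaging over the time index: actions that are functions of the whole source sequence behave,
as far as expectations of additive functions are concerned, like a single conditional law. -/
theorem exists_average_kernel [Nonempty A] {P : X → ℝ} (hP : P ∈ stdSimplex ℝ X) {n : ℕ}
    (hn : 1 ≤ n) (f : (Fin n → X) → (Fin n → A)) :
    ∃ k : X → A → ℝ, (∀ x, k x ∈ stdSimplex ℝ A) ∧ ∀ ψ : X → A → ℝ,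
      ∑ x : Fin n → X, (∏ i, P (x i)) * ∑ i, ψ (x i) (f x i) =
        n * ∑ x, ∑ a, P x * k x a * ψ x a := by
  classical
  have hn0 : (0 : ℝ) < n := by exact_mod_cast hn
  obtain ⟨a₀⟩ := ‹Nonempty A›
  have hPn : ∀ x : Fin n → X, 0 ≤ ∏ i, P (x i) := fun x => Finset.prod_nonneg fun i _ => hP.1 _
  -- The time average of the laws of (X_i, A_i). Its first marginal is `P` because every X_i has law
  -- `P`, however the actions depend on the whole sequence.
  set μ : X → A → ℝ := fun x₀ a => (∑ x : Fin n → X, (∏ i, P (x i)) *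
    ∑ i, if x i = x₀ ∧ f x i = a then (1 : ℝ) else 0) / n with hμ
  have hμ0 : ∀ x a, 0 ≤ μ x a := fun x₀ a => div_nonneg (Finset.sum_nonneg fun x _ =>
    mul_nonneg (hPn x) (Finset.sum_nonneg fun i _ => by split_ifs <;> norm_num)) hn0.le
  have hμs : ∀ x, ∑ a, μ x a = P x := by
    intro x₀
    simp only [hμ]
    rw [← Finset.sum_div, Finset.sum_comm]
    have : ∀ x : Fin n → X, ∑ a, (∏ i, P (x i)) *
        ∑ i, (if x i = x₀ ∧ f x i = a then (1 : ℝ) else 0) =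
        (∏ i, P (x i)) * ∑ i, if x i = x₀ then (1 : ℝ) else 0 := by
      intro x
      rw [← Finset.mul_sum, Finset.sum_comm]
      congr 1
      refine Finset.sum_congr rfl fun i _ => ?_
      by_cases h : x i = x₀ <;> simp [h]
    simp only [this]
    rw [sum_prod_mul_sum_apply (f := fun _ => P) (fun _ => hP.2)
      (fun _ x => if x = x₀ then (1 : ℝ) else 0)]
    simp
    field_simp
  have hμz : ∀ x a, P x = 0 → μ x a = 0 := fun x a h =>
    (Finset.sum_eq_zero_iff_of_nonneg fun a _ => hμ0 x a).1 (by rw [hμs, h]) a (Finset.mem_univ a)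
  -- Conditioning on a null `x` is undefined; the point mass at `a₀` is an arbitrary choice there.
  refine ⟨fun x a => if P x = 0 then (if a = a₀ then 1 else 0) else μ x a / P x, ?_, ?_⟩
  · intro x
    by_cases h : P x = 0
    · simp only [h, if_true]
      exact ⟨fun a => by dsimp only; split_ifs <;> norm_num, by simp⟩
    · simp only [h, if_false]
      refine ⟨fun a => div_nonneg (hμ0 x a) (hP.1 x), ?_⟩
      rw [← Finset.sum_div, hμs, div_self h]
  · intro ψ
    have hk : ∀ x a, P x * (if P x = 0 then (if a = a₀ then 1 else 0) else μ x a / P x) =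
        μ x a := by
      intro x a
      by_cases h : P x = 0
      · simp [h, hμz]
      · simp only [h, if_false]
        field_simp
    simp only [hk]
    simp only [hμ]
    have hexp : ∀ x : Fin n → X, ∑ i, ψ (x i) (f x i) =
        ∑ x₀, ∑ a, (∑ i, if x i = x₀ ∧ f x i = a then (1 : ℝ) else 0) * ψ x₀ a := by
      intro x
      simp only [Finset.sum_mul]
      rw [show (∑ x₀, ∑ a, ∑ i, (if x i = x₀ ∧ f x i = a then (1 : ℝ) else 0) * ψ x₀ a) =
        ∑ i, ∑ x₀, ∑ a, (if x i = x₀ ∧ f x i = a then (1 : ℝ) else 0) * ψ x₀ a from by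
          rw [Finset.sum_comm]
          rw [Finset.sum_congr rfl fun a _ => Finset.sum_comm, Finset.sum_comm]
          exact Finset.sum_congr rfl fun i _ => Finset.sum_comm]
      refine Finset.sum_congr rfl fun i _ => ?_
      rw [Finset.sum_eq_single (x i), Finset.sum_eq_single (f x i)]
      · simp
      · intro a _ ha
        simp [Ne.symm ha]
      · simp
      · intro x₀ _ hx
        simp [Ne.symm hx]
      · simp
    simp only [hexp, Finset.mul_sum]
    rw [Finset.sum_comm]
    refine Finset.sum_congr rfl fun x₀ _ => ?_
    rw [Finset.sum_comm]
    refine Finset.sum_congr rfl fun a _ => ?_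
    simp only [Finset.sum_mul, Finset.sum_div, Finset.mul_sum]
    refine Finset.sum_congr rfl fun x _ => Finset.sum_congr rfl fun i _ => ?_
    field_simp

set_option maxHeartbeats 400000 in
open Classical in
/-- The rate of a code, up to the loss in the inequality of Fano, lies in the single-letter
region. -/
theorem mem_weightRegion_of_code [Nonempty A] [Nonempty X] [Nonempty Y] {P : X → ℝ}
    (hP : P ∈ stdSimplex ℝ X)
    {w : X → A → Y → ℝ} (hw : ∀ x a, w x a ∈ stdSimplex ℝ Y) (Λ : A → ℝ) {n : ℕ} (hn : 1 ≤ n)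
    {S T : Type*} [Fintype S] [Fintype T] [Nonempty S] [Nonempty T]
    (eX : (Fin n → X) → S) (eY : (Fin n → Y) → T) (h : S → Fin n → A)
    (g : S → T → (Fin n → X) × (Fin n → Y)) {C : (Fin n → X) × (Fin n → Y) → Prop}
    (hC : ∀ ω, C ω → ω = g (eX ω.1) (eY ω.2)) {RX RY Γ ε : ℝ}
    (hS : Real.log (Fintype.card S) ≤ n * RX * Real.log 2)
    (hT : Real.log (Fintype.card T) ≤ n * RY * Real.log 2)
    (hΓ : ∑ x : Fin n → X, (∏ i, P (x i)) * ∑ i, Λ (h (eX x) i) ≤ n * Γ)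
    (hε : (∑ ω : (Fin n → X) × (Fin n → Y), if C ω then 0 else
      (∏ i, P (ω.1 i)) * ∏ i, w (ω.1 i) (h (eX ω.1) i) (ω.2 i)) ≤ ε) :
    (RX + (1 / n + ε * (Real.log (Fintype.card X) + Real.log (Fintype.card Y)) / Real.log 2),
      RY + (1 / n + ε * (Real.log (Fintype.card X) + Real.log (Fintype.card Y)) / Real.log 2),
      Γ) ∈ weightRegion P w Λ := by
  have hn0 : (0 : ℝ) < n := by exact_mod_cast hn
  have hlog : 0 < Real.log 2 := Real.log_pos one_lt_two
  obtain ⟨k, hk, hψ⟩ := exists_average_kernel hP hn fun x => h (eX x)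
  have hk0 := fun x a => (hk x).1 a
  have hw0 := fun x a y => (hw x a).1 y
  set p : (Fin n → X) × (Fin n → Y) → ℝ := fun ω =>
    (∏ i, P (ω.1 i)) * ∏ i, w (ω.1 i) (h (eX ω.1) i) (ω.2 i) with hpdef
  have hPn0 : ∀ x : Fin n → X, 0 ≤ ∏ i, P (x i) := fun x => Finset.prod_nonneg fun i _ => hP.1 _
  have hp : p ∈ stdSimplex ℝ ((Fin n → X) × (Fin n → Y)) := by
    refine ⟨fun ω => mul_nonneg (hPn0 _) (Finset.prod_nonneg fun i _ => hw0 _ _ _), ?_⟩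
    rw [Fintype.sum_prod_type]
    simp only [hpdef, ← Finset.mul_sum]
    rw [← sum_prod_eq_one (fun (_ : Fin n) => hP.2)]
    refine Finset.sum_congr rfl fun x _ => ?_
    rw [sum_prod_eq_one (fun i => (hw (x i) (h (eX x) i)).2), mul_one]
  -- Expectations of additive functions single-letterize.
  have hE : ∀ φ : X → A → Y → ℝ,
      ∑ ω, p ω * ∑ i, φ (ω.1 i) (h (eX ω.1) i) (ω.2 i) = n * avg P k w φ := by
    intro φ
    rw [Fintype.sum_prod_type]
    simp only [hpdef, mul_assoc]
    simp only [← Finset.mul_sum]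
    have : ∀ x : Fin n → X, (∑ y : Fin n → Y, (∏ i, w (x i) (h (eX x) i) (y i)) *
        ∑ i, φ (x i) (h (eX x) i) (y i)) =
        ∑ i, (fun x a => ∑ y, w x a y * φ x a y) (x i) (h (eX x) i) := fun x =>
      sum_prod_mul_sum_apply (f := fun i => w (x i) (h (eX x) i))
        (fun i => (hw (x i) (h (eX x) i)).2) fun i => φ (x i) (h (eX x) i)
    simp only [this]
    rw [hψ fun x a => ∑ y, w x a y * φ x a y, avg]
    simp only [Finset.mul_sum, mul_assoc]
  have hpos : ∀ ω, 0 < p ω → ∀ i, 0 < P (ω.1 i) ∧ 0 < w (ω.1 i) (h (eX ω.1) i) (ω.2 i) := by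
    intro ω hω i
    have h1 := left_ne_zero_of_mul hω.ne'
    have h2 := right_ne_zero_of_mul hω.ne'
    rw [Finset.prod_ne_zero_iff] at h1 h2
    exact ⟨(hP.1 _).lt_of_ne' (h1 i (Finset.mem_univ i)),
      (hw0 _ _ _).lt_of_ne' (h2 i (Finset.mem_univ i))⟩
  have hElog : ∀ r : (Fin n → X) × (Fin n → Y) → ℝ, ∀ φ : X → A → Y → ℝ,
      (∀ ω, 0 < p ω → Real.log (r ω) = ∑ i, φ (ω.1 i) (h (eX ω.1) i) (ω.2 i)) →
      ∑ ω, p ω * Real.log (r ω) = n * avg P k w φ := by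
    intro r φ hr
    rw [← hE]
    refine Finset.sum_congr rfl fun ω _ => ?_
    rcases (hp.1 ω).eq_or_lt with h0 | h0
    · simp [← h0]
    · rw [hr ω h0]
  have hplog := hElog p (fun x a y => Real.log (P x) + Real.log (w x a y)) (by
    intro ω hω
    have := hpos ω hω
    rw [Real.log_mul (Finset.prod_pos fun i _ => (this i).1).ne'
      (Finset.prod_pos fun i _ => (this i).2).ne', Real.log_prod fun i _ => (this i).1.ne',
      Real.log_prod fun i _ => (this i).2.ne', Finset.sum_add_distrib])
  set e := ∑ ω, if C ω then 0 else p ω with he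
  have he0 : 0 ≤ e := Finset.sum_nonneg fun ω _ => by
    split_ifs
    exacts [le_rfl, hp.1 ω]
  have hcX : (1 : ℝ) ≤ Fintype.card X := by exact_mod_cast Fintype.card_pos
  have hcY : (1 : ℝ) ≤ Fintype.card Y := by exact_mod_cast Fintype.card_pos
  have hcS : (1 : ℝ) ≤ Fintype.card S := by exact_mod_cast Fintype.card_pos
  have hcT : (1 : ℝ) ≤ Fintype.card T := by exact_mod_cast Fintype.card_pos
  have hlX := Real.log_nonneg hcX
  have hlY := Real.log_nonneg hcY
  -- The Fano loss per letter in bits. The same value serves all three bounds, so the error term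
  -- carries both alphabet sizes.
  set D := 1 / n + ε * (Real.log (Fintype.card X) + Real.log (Fintype.card Y)) / Real.log 2
    with hD
  have hDn : n * (D * Real.log 2) = Real.log 2 +
      n * (ε * (Real.log (Fintype.card X) + Real.log (Fintype.card Y))) := by
    rw [hD]; field_simp
  have hsmall : ∀ t, t ≤ Real.log (Fintype.card X) + Real.log (Fintype.card Y) → 0 ≤ t →
      e * (n * t) ≤ n * (ε * (Real.log (Fintype.card X) + Real.log (Fintype.card Y))) := by
    intro t ht ht0
    have : e * t ≤ ε * (Real.log (Fintype.card X) + Real.log (Fintype.card Y)) :=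
      mul_le_mul hε ht ht0 (he0.trans hε)
    nlinarith
  refine ⟨k, hk, ?_, ?_, ?_, ?_⟩
  · -- The bound on the rate of the first encoder.
    have hmy := margAY_nonneg hP.1 hk0 hw0
    have hm := margA_nonneg hP.1 hk0
    have hle := margAY_le_margA hP.1 hk0 hw
    -- P_{Y|A} under the averaged kernel, equal to zero at actions of probability zero.
    set Q : A → Y → ℝ := fun a y => margAY P k w a y / margA P k a with hQ
    have hQ0 : ∀ a y, 0 ≤ Q a y := fun a y => div_nonneg (hmy a y) (hm a)
    have hQs : ∀ a, ∑ y, Q a y ≤ 1 := fun a => by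
      rw [hQ, ← Finset.sum_div, sum_margAY (fun x a => (hw x a).2)]
      exact div_self_le_one _
    have hQn : ∀ b : Fin n → A, ∑ y : Fin n → Y, ∏ i, Q (b i) (y i) ≤ 1 := fun b => by
      rw [sum_prod_pi fun i => Q (b i)]
      exact Finset.prod_le_one (fun i _ => Finset.sum_nonneg fun y _ => hQ0 _ _) fun i _ => hQs _
    have hQp : ∀ ω, 0 < p ω → ∀ i, 0 < Q (h (eX ω.1) i) (ω.2 i) := by
      intro ω hω i
      have hPω : 0 < ∏ i, P (ω.1 i) := Finset.prod_pos fun i _ => (hpos ω hω i).1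
      have hPk : 0 < P (ω.1 i) * k (ω.1 i) (h (eX ω.1) i) := by
        -- Testing the averaged kernel on the indicator of one letter pair shows that a pair
        -- occurring at some time with positive probability keeps positive mass.
        have h1 := hψ fun x a => if x = ω.1 i ∧ a = h (eX ω.1) i then 1 else 0
        have h2 : 0 < ∑ x : Fin n → X, (∏ i, P (x i)) *
            ∑ j, if x j = ω.1 i ∧ h (eX x) j = h (eX ω.1) i then (1 : ℝ) else 0 := by
          have hnn : ∀ x : Fin n → X, ∀ j ∈ Finset.univ, (0 : ℝ) ≤
            if x j = ω.1 i ∧ h (eX x) j = h (eX ω.1) i then (1 : ℝ) else 0 := fun x j _ => by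
              split_ifs <;> norm_num
          refine Finset.sum_pos' (fun x _ => mul_nonneg (hPn0 x)
            (Finset.sum_nonneg (hnn x))) ⟨ω.1, Finset.mem_univ _, mul_pos hPω ?_⟩
          exact Finset.sum_pos' (hnn ω.1) ⟨i, Finset.mem_univ i, by simp⟩
        rw [h1] at h2
        have h3 := pos_of_mul_pos_right h2 hn0.le
        rw [Finset.sum_eq_single (ω.1 i), Finset.sum_eq_single (h (eX ω.1) i)] at h3
        · simpa using h3
        · intro a _ ha
          simp [ha]
        · simp
        · intro x _ hx
          simp [hx]
        · simp
      have h4 : 0 < margAY P k w (h (eX ω.1) i) (ω.2 i) :=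
        (mul_pos hPk (hpos ω hω i).2).trans_le (le_margAY hP.1 hk0 hw0 _ _ _)
      exact div_pos h4 (h4.trans_le (hle _ _))
    have hcount := sum_correct_le_card_fst (e := eX) (f := eY) (g := g) hC
      (F := fun s y => ∏ i, Q (h s i) (y i))
      (fun s y => Finset.prod_nonneg fun i _ => hQ0 _ _) fun s => hQn (h s)
    have hf := sum_mul_log_sub_le (M := Fintype.card S) (N := (Fintype.card X : ℝ) ^ n) hp
      (r := fun ω => ∏ i, Q (h (eX ω.1) i) (ω.2 i))
      (fun ω => Finset.prod_nonneg fun i _ => hQ0 _ _)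
      (fun ω hω => Finset.prod_pos fun i _ => hQp ω hω i) C hcS
      (one_le_pow₀ hcX (n := n))
      hcount (by
        rw [Fintype.sum_prod_type]
        calc _ ≤ ∑ x : Fin n → X, (1 : ℝ) := Finset.sum_le_sum fun x _ => hQn (h (eX x))
          _ = (Fintype.card X : ℝ) ^ n := by simp)
    rw [hElog _ (fun x a y => Real.log (Q a y)) (fun ω hω =>
      Real.log_prod fun i _ => (hQp ω hω i).ne'), hplog, Real.log_pow] at hf
    have hr : rateX P k w = avg P k w (fun x a y => Real.log (Q a y)) -
        avg P k w (fun x a y => Real.log (P x) + Real.log (w x a y)) := by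
      rw [← avg_sub, rateX]
      congr 1
      funext x a y
      simp only [hQ]
      ring
    have := hsmall _ (le_add_of_nonneg_right hlY) hlX
    have : n * rateX P k w ≤ n * ((RX + D) * Real.log 2) := by
      rw [hr]
      linarith
    exact le_of_mul_le_mul_left this hn0
  · -- The bound on the rate of the second encoder.
    have hcount := sum_correct_le_card_snd (e := eX) (f := eY) (g := g) hC
      (F := fun x => ∏ i, P (x i)) hPn0 (sum_prod_eq_one (fun (_ : Fin n) => hP.2)).le
    have hf := sum_mul_log_sub_le (M := Fintype.card T) (N := (Fintype.card Y : ℝ) ^ n) hp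
      (r := fun ω => ∏ i, P (ω.1 i)) (fun ω => hPn0 ω.1)
      (fun ω hω => Finset.prod_pos fun i _ => (hpos ω hω i).1) C hcT
      (one_le_pow₀ hcY (n := n))
      hcount (by
        rw [Fintype.sum_prod_type, Finset.sum_comm, Finset.sum_congr rfl fun t _ =>
          sum_prod_eq_one (fun (_ : Fin n) => hP.2)]
        simp)
    rw [hElog _ (fun x a y => Real.log (P x)) (fun ω hω =>
      Real.log_prod fun i _ => (hpos ω hω i).1.ne'), hplog, Real.log_pow] at hf
    have hr : rateY P k w = avg P k w (fun x a y => Real.log (P x)) -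
        avg P k w (fun x a y => Real.log (P x) + Real.log (w x a y)) := by
      rw [← avg_sub, rateY]
      congr 1
      funext x a y
      ring
    have := hsmall _ (le_add_of_nonneg_left hlX) hlY
    have : n * rateY P k w ≤ n * ((RY + D) * Real.log 2) := by
      rw [hr]
      linarith
    exact le_of_mul_le_mul_left this hn0
  · -- The bound on the sum of the rates.
    have hf := sum_mul_log_sub_le (M := (Fintype.card S : ℝ) * Fintype.card T)
      (N := (Fintype.card X : ℝ) ^ n * (Fintype.card Y : ℝ) ^ n) hp (r := fun _ => 1)
      (fun _ => zero_le_one)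
      (fun _ _ => one_pos) C (one_le_mul_of_one_le_of_one_le hcS hcT)
      (one_le_mul_of_one_le_of_one_le (one_le_pow₀ hcX (n := n)) (one_le_pow₀ hcY (n := n)))
      (sum_correct_le_card hC) (by simp)
    have h1 : ∑ ω, p ω * Real.log ((fun _ => (1 : ℝ)) ω) = 0 := by simp
    rw [h1, hplog, Real.log_mul (by positivity) (by positivity),
      Real.log_mul (by positivity) (by positivity), Real.log_pow, Real.log_pow] at hf
    have hr : rateSum P k w =
        - avg P k w (fun x a y => Real.log (P x) + Real.log (w x a y)) := by
      rw [← avg_neg, rateSum]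
      congr 1
      funext x a y
      ring
    have := hsmall _ le_rfl (add_nonneg hlX hlY)
    -- The sum of the rates is granted `D` twice but needs it once; the spare copy has to be
    -- nonnegative.
    have hD0 : 0 ≤ n * (D * Real.log 2) := by
      rw [hDn]
      have := he0.trans hε
      positivity
    have : n * rateSum P k w ≤ n * ((RX + D + (RY + D)) * Real.log 2) := by
      rw [hr]
      linarith
    exact le_of_mul_le_mul_left this hn0
  · have := hψ fun _ a => Λ a
    rw [this] at hΓ
    exact le_of_mul_le_mul_left hΓ hn0

end Converse

/-- At a negative rate the floor can vanish, and then `Real.log 0 = 0` breaks the bound. An encoder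
into the message set rules this case out. -/
theorem log_natFloor_rpow_le (n : ℕ) (R : ℝ) :
    Real.log (⌊(2 : ℝ) ^ ((n : ℝ) * R)⌋₊ : ℝ) ≤ n * R * Real.log 2 ∨
      ⌊(2 : ℝ) ^ ((n : ℝ) * R)⌋₊ = 0 := by
  rcases Nat.eq_zero_or_pos ⌊(2 : ℝ) ^ ((n : ℝ) * R)⌋₊ with h | h
  · exact Or.inr h
  · left
    rw [← Real.log_rpow two_pos]
    exact Real.log_le_log (by exact_mod_cast h) (Nat.floor_le (by positivity))

/-- Each code places its rates, increased by the Fano loss, in the region; the loss tends to zero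
and the region is closed. -/
theorem mem_weightRegion_of_achievable {X A Y : Type*} [Fintype X] [Fintype A] [Fintype Y]
    {P : PMF X} {W : X → A → PMF Y} {Λ : A → ℝ} {Γ RX RY : ℝ}
    (h : Achievable P W Λ Γ RX RY) :
    (RX, RY, Γ) ∈ weightRegion (fun x => (P x).toReal) (fun x a y => (W x a y).toReal) Λ := by
  classical
  obtain ⟨c, hc, ht⟩ := h
  have hP := toReal_mem_stdSimplex P
  have hw := fun x a => toReal_mem_stdSimplex (W x a)
  obtain ⟨x₀, -⟩ := P.support_nonempty
  have : Nonempty X := ⟨x₀⟩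
  -- Block length 1 is the shortest at which a code exhibits an action.
  have : Nonempty A := ⟨(c 1).actions (fun _ => x₀) 0⟩
  have : Nonempty Y := ⟨(W x₀ (Classical.arbitrary A)).support_nonempty.some⟩
  have hmem : ∀ n : ℕ, 1 ≤ n →
      (RX + (1 / n + (c n).errorProb P W * (Real.log (Fintype.card X) + Real.log (Fintype.card Y))
          / Real.log 2),
        RY + (1 / n + (c n).errorProb P W * (Real.log (Fintype.card X) +
          Real.log (Fintype.card Y)) / Real.log 2), Γ) ∈
      weightRegion (fun x => (P x).toReal) (fun x a y => (W x a y).toReal) Λ := by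
    intro n hn
    have hn0 : (0 : ℝ) < n := by exact_mod_cast hn
    have : Nonempty (Message n RX) := ⟨(c n).encX fun _ => x₀⟩
    have : Nonempty (Message n RY) := ⟨(c n).encY fun _ => Classical.arbitrary Y⟩
    refine mem_weightRegion_of_code hP hw Λ hn (c n).encX (c n).encY (c n).strategy
      (c n).decode (C := fun ω => ω = (c n).decode ((c n).encX ω.1) ((c n).encY ω.2))
      (fun _ h => h) ?_ ?_ ?_ ?_
    · rw [Fintype.card_fin]
      refine (log_natFloor_rpow_le n RX).resolve_right fun h => ?_
      exact (Fin.pos ((c n).encX fun _ => x₀)).ne' h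
    · rw [Fintype.card_fin]
      refine (log_natFloor_rpow_le n RY).resolve_right fun h => ?_
      exact (Fin.pos ((c n).encY fun _ => Classical.arbitrary Y)).ne' h
    · have := mul_le_mul_of_nonneg_left (hc n hn) hn0.le
      refine le_trans (le_of_eq ?_) this
      rw [Code.expectedCost, Finset.mul_sum]
      refine Finset.sum_congr rfl fun x _ => ?_
      simp only [Code.actions]
      field_simp
    · rw [Fintype.sum_prod_type, Code.errorProb]
      refine Finset.sum_le_sum fun x _ => Finset.sum_le_sum fun y _ => ?_
      by_cases hxy : (x, y) = (c n).decode ((c n).encX x) ((c n).encY y)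
      · simp [← hxy]
      · simp only [hxy, ne_eq, not_false_eq_true, if_true, if_false]
        exact le_rfl
  have hlim : Filter.Tendsto (fun n : ℕ => 1 / (n : ℝ) + (c n).errorProb P W *
      (Real.log (Fintype.card X) + Real.log (Fintype.card Y)) / Real.log 2)
      Filter.atTop (𝓝 0) := by
    simpa using tendsto_one_div_atTop_nhds_zero_nat.add ((ht.mul_const
      (Real.log (Fintype.card X) + Real.log (Fintype.card Y))).div_const (Real.log 2))
  refine (isClosed_weightRegion hP hw Λ).mem_of_tendsto (b := Filter.atTop)
    (f := fun n : ℕ => (RX + (1 / (n : ℝ) + (c n).errorProb P W *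
      (Real.log (Fintype.card X) + Real.log (Fintype.card Y)) / Real.log 2),
      RY + (1 / (n : ℝ) + (c n).errorProb P W *
      (Real.log (Fintype.card X) + Real.log (Fintype.card Y)) / Real.log 2), Γ)) ?_ ?_
  · simpa using (hlim.const_add RX).prodMk_nhds ((hlim.const_add RY).prodMk_nhds
      (tendsto_const_nhds (x := Γ)))
  · filter_upwards [Filter.eventually_ge_atTop 1] with n hn using hmem n hn

/-! One-shot achievability: covering and random binning. -/

/-- The probabilistic method: some outcome does no worse than the mean. -/
theorem exists_le_of_sum_mul_le {Ω : Type*} [Fintype Ω] {u F : Ω → ℝ} (hu : u ∈ stdSimplex ℝ Ω)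
    {B : ℝ} (h : ∑ ω, u ω * F ω ≤ B) : ∃ ω, F ω ≤ B := by
  by_contra! hc
  have h1 : ∑ ω, u ω * (F ω - B) ≤ 0 := by
    simp only [mul_sub, Finset.sum_sub_distrib, ← Finset.sum_mul, hu.2]
    linarith
  have h2 : ∀ ω ∈ Finset.univ, 0 ≤ u ω * (F ω - B) := fun ω _ =>
    mul_nonneg (hu.1 ω) (sub_nonneg.2 (hc ω).le)
  have h3 := (Finset.sum_eq_zero_iff_of_nonneg h2).1 (le_antisymm h1 (Finset.sum_nonneg h2))
  have h4 : ∀ ω, u ω = 0 := fun ω =>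
    (mul_eq_zero.1 (h3 ω (Finset.mem_univ ω))).resolve_right (sub_pos.2 (hc ω)).ne'
  have := hu.2
  simp [h4] at this

/-- Convexity of the exponential on the segment from 0 to -t, with the weight `s` of the last term
dropped. -/
theorem exp_neg_mul_le {s t : ℝ} (hs : 0 ≤ s) (hs1 : s ≤ 1) :
    Real.exp (-(s * t)) ≤ 1 - s + Real.exp (-t) := by
  have := convexOn_exp.2 (Set.mem_univ 0) (Set.mem_univ (-t)) (sub_nonneg.2 hs1) hs
    (sub_add_cancel 1 s)
  simp only [smul_eq_mul, mul_zero, zero_add, Real.exp_zero, mul_one, mul_neg] at this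
  have h := mul_le_of_le_one_left (Real.exp_pos (-t)).le hs1
  linarith

open Classical in
/-- Covering: a codebook drawn from the output law contains, for most `x`, an entry that is
related to `x`. -/
theorem exists_codebook {X A : Type*} [Fintype X] [Fintype A] {P : X → ℝ}
    (hP : P ∈ stdSimplex ℝ X) {k : X → A → ℝ} (hk : ∀ x, k x ∈ stdSimplex ℝ A)
    {G : X → A → Prop} {L : ℝ} (hL : 0 < L) (hG : ∀ x a, G x a → k x a ≤ L * margA P k a)
    (M : ℕ) : ∃ c : Fin M → A, ∑ x, (if ∃ j, G x (c j) then 0 else P x) ≤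
      ∑ x, ∑ a, (if G x a then 0 else P x * k x a) + Real.exp (-(M / L)) := by
  have hm := margA_nonneg hP.1 fun x a => (hk x).1 a
  have hms : ∑ a, margA P k a = 1 := by rw [sum_margA fun x => (hk x).2, hP.2]
  refine exists_le_of_sum_mul_le (u := fun c : Fin M → A => ∏ j, margA P k (c j))
    ⟨fun c => Finset.prod_nonneg fun j _ => hm _, sum_prod_eq_one fun _ => hms⟩ ?_
  -- The codewords are independent, so the probability of missing `x` with all of them is a power.
  have hterm : ∀ x, ∑ c : Fin M → A, (∏ j, margA P k (c j)) *
      (if ∃ j, G x (c j) then 0 else P x) =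
      P x * (∑ a, if G x a then 0 else margA P k a) ^ M := by
    intro x
    have : (∑ a, if G x a then 0 else margA P k a) ^ M =
        ∑ c : Fin M → A, ∏ j, if G x (c j) then 0 else margA P k (c j) := by
      rw [sum_prod_pi fun (_ : Fin M) a => if G x a then 0 else margA P k a]
      simp
    rw [this, Finset.mul_sum]
    refine Finset.sum_congr rfl fun c _ => ?_
    by_cases h : ∃ j, G x (c j)
    · obtain ⟨j, hj⟩ := h
      have hz : ∏ j, (if G x (c j) then 0 else margA P k (c j)) = 0 :=
        Finset.prod_eq_zero (Finset.mem_univ j) (if_pos hj)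
      rw [if_pos ⟨j, hj⟩, hz]
      simp
    · rw [if_neg h, mul_comm]
      congr 1
      exact Finset.prod_congr rfl fun j _ => (if_neg fun hj => h ⟨j, hj⟩).symm
  simp only [Finset.mul_sum]
  rw [Finset.sum_comm]
  simp only [hterm]
  have hb : ∀ x, P x * (∑ a, if G x a then 0 else margA P k a) ^ M ≤
      ∑ a, (if G x a then 0 else P x * k x a) + P x * Real.exp (-(M / L)) := by
    intro x
    set s := ∑ a, if G x a then k x a else 0 with hs
    have hs0 : 0 ≤ s := Finset.sum_nonneg fun a _ => by
      split_ifs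
      exacts [(hk x).1 a, le_rfl]
    have hsplit : s + ∑ a, (if G x a then 0 else k x a) = 1 := by
      rw [hs, ← Finset.sum_add_distrib, ← (hk x).2]
      exact Finset.sum_congr rfl fun a _ => by split_ifs <;> simp
    have hn0 : 0 ≤ ∑ a, (if G x a then 0 else k x a) := Finset.sum_nonneg fun a _ => by
      split_ifs
      exacts [le_rfl, (hk x).1 a]
    -- Change of measure: `s` is the mass of the good actions under the kernel, so under the output
    -- law it is at least s/L.
    have hmiss : ∑ a, (if G x a then 0 else margA P k a) ≤ 1 - s / L := by
      have h1 : ∑ a, (if G x a then 0 else margA P k a) +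
          ∑ a, (if G x a then margA P k a else 0) = 1 := by
        rw [← Finset.sum_add_distrib, ← hms]
        exact Finset.sum_congr rfl fun a _ => by split_ifs <;> simp
      have h2 : s / L ≤ ∑ a, (if G x a then margA P k a else 0) := by
        rw [hs, Finset.sum_div]
        refine Finset.sum_le_sum fun a _ => ?_
        split_ifs with h
        · rw [div_le_iff₀ hL, mul_comm]
          exact hG x a h
        · simp
      linarith
    have hmiss0 : 0 ≤ ∑ a, (if G x a then 0 else margA P k a) := Finset.sum_nonneg fun a _ => by
      split_ifs
      exacts [le_rfl, hm a]
    have hpow : (∑ a, if G x a then 0 else margA P k a) ^ M ≤ 1 - s + Real.exp (-(M / L)) := by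
      calc _ ≤ (Real.exp (-(s / L))) ^ M := by
            refine pow_le_pow_left₀ hmiss0 (hmiss.trans ?_) M
            have := Real.add_one_le_exp (-(s / L))
            linarith
        _ = Real.exp (-(s * (M / L))) := by
            rw [← Real.exp_nat_mul]
            congr 1
            ring
        _ ≤ _ := exp_neg_mul_le hs0 (by linarith)
    have : ∑ a, (if G x a then 0 else P x * k x a) = P x * (1 - s) := by
      rw [← hsplit, add_sub_cancel_left, Finset.mul_sum]
      exact Finset.sum_congr rfl fun a _ => by split_ifs <;> simp
    rw [this, ← mul_add]
    exact mul_le_mul_of_nonneg_left hpow (hP.1 x)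
  refine (Finset.sum_le_sum fun x _ => hb x).trans (le_of_eq ?_)
  rw [Finset.sum_add_distrib, ← Finset.sum_mul, hP.2, one_mul]

/-! ### Random binning. -/

theorem sum_prod_mul_apply_mul_apply {ι α : Type*} [Fintype ι] [DecidableEq ι] [Fintype α]
    {f : ι → α → ℝ} (hf : ∀ i, ∑ a, f i a = 1) {i j : ι} (hij : i ≠ j) (φ χ : α → ℝ) :
    ∑ x : ι → α, (∏ l, f l (x l)) * (φ (x i) * χ (x j)) =
      (∑ a, f i a * φ a) * ∑ a, f j a * χ a := by
  have h : ∀ x : ι → α, (∏ l, f l (x l)) * (φ (x i) * χ (x j)) =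
      ∏ l, f l (x l) * ((if l = i then φ (x l) else 1) * (if l = j then χ (x l) else 1)) := by
    intro x
    rw [Finset.prod_mul_distrib, Finset.prod_mul_distrib,
      Finset.prod_ite_eq' Finset.univ i (fun l => φ (x l)),
      Finset.prod_ite_eq' Finset.univ j (fun l => χ (x l))]
    simp
  simp_rw [h]
  rw [sum_prod_pi (fun l a => f l a * ((if l = i then φ a else 1) * (if l = j then χ a else 1)))]
  have h2 : ∀ l, ∑ a, f l a * ((if l = i then φ a else 1) * (if l = j then χ a else 1)) =
      (if l = i then ∑ a, f l a * φ a else 1) * (if l = j then ∑ a, f l a * χ a else 1) := by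
    intro l
    by_cases h1 : l = i
    · have h2 : l ≠ j := fun h2 => hij (h1.symm.trans h2)
      simp [h1, hij]
    · by_cases h2 : l = j
      · simp [h2, hij.symm]
      · simp [h1, h2, hf]
  simp_rw [h2]
  rw [Finset.prod_mul_distrib, Finset.prod_ite_eq' Finset.univ i (fun l => ∑ a, f l a * φ a),
    Finset.prod_ite_eq' Finset.univ j (fun l => ∑ a, f l a * χ a)]
  simp

open Classical in
/-- The probability that a uniformly random function identifies two points. -/
theorem sum_collision {α : Type*} [Fintype α] (M : ℕ) (hM : 0 < M) (x x' : α) :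
    ∑ b : α → Fin M, (∏ _z : α, (1 / (M : ℝ))) * (if b x' = b x then 1 else 0) =
      if x' = x then 1 else 1 / (M : ℝ) := by
  have hM0 : (M : ℝ) ≠ 0 := by exact_mod_cast hM.ne'
  have hs : ∑ _a : Fin M, (1 / (M : ℝ)) = 1 := by simp [hM0]
  by_cases h : x' = x
  · simp only [h, if_true, mul_one]
    exact sum_prod_eq_one (f := fun (_ : α) (_ : Fin M) => 1 / (M : ℝ)) fun _ => hs
  · rw [if_neg h]
    have h1 : ∀ b : α → Fin M, (∏ _z : α, (1 / (M : ℝ))) * (if b x' = b x then 1 else 0) =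
        ∑ m, (∏ _z : α, (1 / (M : ℝ))) *
          ((if b x' = m then (1 : ℝ) else 0) * (if b x = m then 1 else 0)) := by
      intro b
      rw [← Finset.mul_sum]
      congr 1
      rw [Finset.sum_eq_single (b x)]
      · simp
      · intro m _ hm
        simp [Ne.symm hm]
      · simp
    simp only [h1]
    rw [Finset.sum_comm]
    have h2 : ∀ m : Fin M, ∑ b : α → Fin M, (∏ _z : α, (1 / (M : ℝ))) *
          ((if b x' = m then (1 : ℝ) else 0) * (if b x = m then 1 else 0)) =
          1 / (M : ℝ) * (1 / (M : ℝ)) := by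
      intro m
      rw [sum_prod_mul_apply_mul_apply (f := fun (_ : α) (_ : Fin M) => 1 / (M : ℝ))
        (fun _ => hs) h (fun a => if a = m then (1 : ℝ) else 0) fun a => if a = m then 1 else 0]
      simp
    simp only [h2]
    simp only [Finset.sum_const, Finset.card_univ, Fintype.card_fin, nsmul_eq_mul]
    field_simp

open Classical in
/-- Random binning of two sources, where the candidates of the decoder may depend on the first
source. -/
theorem exists_bins {X Y : Type*} [Fintype X] [Fintype Y] {p : X → Y → ℝ}
    (hp : ∀ x y, 0 ≤ p x y) (hps : ∑ x, ∑ y, p x y = 1) {D : X → X → Y → Prop} {L₁ L₂ L₃ : ℝ}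
    (h₁ : ∀ x y, ∑ x', (if D x x' y then (1 : ℝ) else 0) ≤ L₁)
    (h₂ : ∀ x, ∑ y', (if D x x y' then (1 : ℝ) else 0) ≤ L₂)
    (h₃ : ∀ x, ∑ x', ∑ y', (if D x x' y' then (1 : ℝ) else 0) ≤ L₃)
    {M N : ℕ} (hM : 0 < M) (hN : 0 < N) :
    ∃ (b : X → Fin M) (d : Y → Fin N),
      ∑ x, ∑ y, (if ∃ x' y', (x', y') ≠ (x, y) ∧ D x x' y' ∧ b x' = b x ∧ d y' = d y
        then p x y else 0) ≤ L₁ / M + L₂ / N + L₃ / (M * N) := by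
  have hM0 : (0 : ℝ) < M := by exact_mod_cast hM
  have hN0 : (0 : ℝ) < N := by exact_mod_cast hN
  set u : ℝ := ∏ _z : X, (1 / (M : ℝ)) with hu
  set v : ℝ := ∏ _z : Y, (1 / (N : ℝ)) with hv
  have hu0 : 0 ≤ u := Finset.prod_nonneg fun _ _ => by positivity
  have hv0 : 0 ≤ v := Finset.prod_nonneg fun _ _ => by positivity
  have hus : ∑ _b : X → Fin M, u = 1 :=
    sum_prod_eq_one (f := fun (_ : X) (_ : Fin M) => 1 / (M : ℝ)) fun _ => by simp [hM0.ne']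
  have hvs : ∑ _d : Y → Fin N, v = 1 :=
    sum_prod_eq_one (f := fun (_ : Y) (_ : Fin N) => 1 / (N : ℝ)) fun _ => by simp [hN0.ne']
  suffices H : ∃ bd : (X → Fin M) × (Y → Fin N), ∑ x, ∑ y,
      (if ∃ x' y', (x', y') ≠ (x, y) ∧ D x x' y' ∧ bd.1 x' = bd.1 x ∧ bd.2 y' = bd.2 y
        then p x y else 0) ≤ L₁ / M + L₂ / N + L₃ / (M * N) from
    let ⟨bd, h⟩ := H
    ⟨bd.1, bd.2, h⟩
  refine exists_le_of_sum_mul_le (u := fun _ => u * v) ⟨fun _ => mul_nonneg hu0 hv0, ?_⟩ ?_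
  · rw [Fintype.sum_prod_type]
    simp only [← Finset.mul_sum, hvs, mul_one, hus]
  -- The union bound for a fixed pair.
  have hpair : ∀ x y, ∑ bd : (X → Fin M) × (Y → Fin N), u * v *
      (if ∃ x' y', (x', y') ≠ (x, y) ∧ D x x' y' ∧ bd.1 x' = bd.1 x ∧ bd.2 y' = bd.2 y
        then p x y else 0) ≤ p x y * (L₁ / M + L₂ / N + L₃ / (M * N)) := by
    intro x y
    have hub : ∀ bd : (X → Fin M) × (Y → Fin N), u * v *
        (if ∃ x' y', (x', y') ≠ (x, y) ∧ D x x' y' ∧ bd.1 x' = bd.1 x ∧ bd.2 y' = bd.2 y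
          then p x y else 0) ≤ ∑ x', ∑ y', p x y *
          ((if (x', y') ≠ (x, y) ∧ D x x' y' then 1 else 0) *
          ((u * if bd.1 x' = bd.1 x then 1 else 0) * (v * if bd.2 y' = bd.2 y then 1 else 0))) := by
      intro bd
      have hnn : ∀ x' y', 0 ≤ p x y *
          ((if (x', y') ≠ (x, y) ∧ D x x' y' then 1 else 0) *
          ((u * if bd.1 x' = bd.1 x then 1 else 0) *
            (v * if bd.2 y' = bd.2 y then 1 else 0))) := by
        intro x' y'
        have h1 : (0 : ℝ) ≤ if (x', y') ≠ (x, y) ∧ D x x' y' then 1 else 0 := by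
          split_ifs <;> norm_num
        have h2 : (0 : ℝ) ≤ if bd.1 x' = bd.1 x then 1 else 0 := by split_ifs <;> norm_num
        have h3 : (0 : ℝ) ≤ if bd.2 y' = bd.2 y then 1 else 0 := by split_ifs <;> norm_num
        exact mul_nonneg (hp x y) (mul_nonneg h1 (mul_nonneg (mul_nonneg hu0 h2)
          (mul_nonneg hv0 h3)))
      split_ifs with hex
      · obtain ⟨x', y', hne, hD, hb, hd⟩ := hex
        have e1 := Finset.single_le_sum (f := fun y' => p x y *
          ((if (x', y') ≠ (x, y) ∧ D x x' y' then 1 else 0) *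
          ((u * if bd.1 x' = bd.1 x then 1 else 0) *
            (v * if bd.2 y' = bd.2 y then 1 else 0)))) (fun y' _ => hnn x' y')
            (Finset.mem_univ y')
        have e2 := Finset.single_le_sum (f := fun x' => ∑ y', p x y *
          ((if (x', y') ≠ (x, y) ∧ D x x' y' then 1 else 0) *
          ((u * if bd.1 x' = bd.1 x then 1 else 0) *
            (v * if bd.2 y' = bd.2 y then 1 else 0))))
            (fun x' _ => Finset.sum_nonneg fun y' _ => hnn x' y') (Finset.mem_univ x')
        refine le_trans (le_of_eq ?_) (e1.trans e2)
        simp only [hb, hd, if_true, if_pos (And.intro hne hD)]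
        ring
      · rw [mul_zero]
        exact Finset.sum_nonneg fun x' _ => Finset.sum_nonneg fun y' _ => hnn x' y'
    refine (Finset.sum_le_sum fun bd _ => hub bd).trans ?_
    rw [Finset.sum_comm]
    have hswap : ∀ x', ∑ bd : (X → Fin M) × (Y → Fin N), ∑ y', p x y *
          ((if (x', y') ≠ (x, y) ∧ D x x' y' then 1 else 0) *
          ((u * if bd.1 x' = bd.1 x then 1 else 0) * (v * if bd.2 y' = bd.2 y then 1 else 0))) =
        ∑ y', p x y * ((if (x', y') ≠ (x, y) ∧ D x x' y' then 1 else 0) *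
          ((if x' = x then 1 else 1 / (M : ℝ)) * (if y' = y then 1 else 1 / (N : ℝ)))) := by
      intro x'
      rw [Finset.sum_comm]
      refine Finset.sum_congr rfl fun y' _ => ?_
      rw [← Finset.mul_sum, ← Finset.mul_sum, Fintype.sum_prod_type]
      have hprod := Finset.sum_mul_sum Finset.univ Finset.univ
        (fun b : X → Fin M => u * if b x' = b x then 1 else 0)
        fun d : Y → Fin N => v * if d y' = d y then 1 else 0
      dsimp only at hprod ⊢
      rw [← hprod, hu, hv,
        sum_collision M hM x x', sum_collision N hN y y']
    simp only [hswap]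
    -- A wrong candidate errs in `x` alone, in `y` alone, or in both; it survives the binning with
    -- probability 1/M, 1/N or 1/(MN) respectively.
    have hbound : ∀ x' y', (if (x', y') ≠ (x, y) ∧ D x x' y' then (1 : ℝ) else 0) *
          ((if x' = x then 1 else 1 / (M : ℝ)) * (if y' = y then 1 else 1 / (N : ℝ))) ≤
        (if y' = y then (if D x x' y' then 1 else 0) else 0) / M +
        (if x' = x then (if D x x' y' then 1 else 0) else 0) / N +
        (if D x x' y' then 1 else 0) / (M * N) := by
      intro x' y'
      have hMN : (0 : ℝ) ≤ 1 / (M * N) := by positivity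
      have hM1 : (0 : ℝ) ≤ 1 / M := by positivity
      have hN1 : (0 : ℝ) ≤ 1 / N := by positivity
      by_cases hD : D x x' y'
      · rcases eq_or_ne x' x with rfl | hx <;> rcases eq_or_ne y' y with rfl | hy
        · simp only [ne_eq, not_true_eq_false, false_and, if_false, zero_mul, if_true, if_pos hD]
          positivity
        · simp only [hy, hD, if_true, if_false, Prod.mk.injEq, and_false, ne_eq,
            not_false_eq_true, true_and, one_mul, zero_div, zero_add]
          linarith
        · simp only [hx, hD, if_true, if_false, Prod.mk.injEq, false_and, ne_eq,
            not_false_eq_true, true_and, one_mul, mul_one, zero_div, add_zero]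
          linarith
        · simp only [hx, hy, hD, if_true, if_false, Prod.mk.injEq, false_and, ne_eq,
            not_false_eq_true, true_and]
          rw [one_div_mul_one_div]
          simp
      · simp [hD]
    simp only [← Finset.mul_sum]
    refine mul_le_mul_of_nonneg_left ?_ (hp x y)
    refine (Finset.sum_le_sum fun x' _ => Finset.sum_le_sum fun y' _ => hbound x' y').trans ?_
    simp only [Finset.sum_add_distrib, ← Finset.sum_div]
    refine add_le_add (add_le_add ?_ ?_) ?_
    · refine div_le_div_of_nonneg_right ?_ hM0.le
      simpa using h₁ x y
    · refine div_le_div_of_nonneg_right ?_ hN0.le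
      rw [Finset.sum_comm]
      simpa using h₂ x
    · exact div_le_div_of_nonneg_right (h₃ x) (by positivity)
  simp only [Finset.mul_sum]
  rw [Finset.sum_comm]
  have : ∀ x, ∑ bd : (X → Fin M) × (Y → Fin N), ∑ y, u * v *
      (if ∃ x' y', (x', y') ≠ (x, y) ∧ D x x' y' ∧ bd.1 x' = bd.1 x ∧ bd.2 y' = bd.2 y
        then p x y else 0) ≤ ∑ y, p x y * (L₁ / M + L₂ / N + L₃ / (M * N)) := by
    intro x
    rw [Finset.sum_comm]
    exact Finset.sum_le_sum fun y _ => hpair x y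
  refine (Finset.sum_le_sum fun x _ => this x).trans (le_of_eq ?_)
  simp only [← Finset.sum_mul]
  rw [hps, one_mul]

/-! ### The one-shot code. -/

open Classical in
/-- A one-shot code: the first encoder describes a covering codeword and a bin of its source, the
second encoder a bin of its source, and the decoder looks for a pair in the relation `T`. -/
theorem exists_one_shot_code {X A Y : Type*} [Fintype X] [Fintype A] [Fintype Y] {P : X → ℝ}
    (hP : P ∈ stdSimplex ℝ X) {k : X → A → ℝ} (hk : ∀ x, k x ∈ stdSimplex ℝ A)
    {w : X → A → Y → ℝ} (hw : ∀ x a, w x a ∈ stdSimplex ℝ Y) {T : X → A → Y → Prop}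
    {B : A → Prop} {a₀ : A} (ha₀ : B a₀) {L L₁ L₂ L₃ δ : ℝ} (hL : 0 < L) (hδ : 0 < δ)
    (hδ1 : δ < 1) (hT : ∀ x a y, T x a y → k x a ≤ L * margA P k a ∧ B a)
    (h₁ : ∀ a y, ∑ x, (if T x a y then (1 : ℝ) else 0) ≤ L₁)
    (h₂ : ∀ x a, ∑ y, (if T x a y then (1 : ℝ) else 0) ≤ L₂)
    (h₃ : ∀ a, ∑ x, ∑ y, (if T x a y then (1 : ℝ) else 0) ≤ L₃)
    {M₁ M₂ N : ℕ} (hM₁ : 0 < M₁) (hM₂ : 0 < M₂) (hN : 0 < N) :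
    ∃ (f : X → Fin M₁ × Fin M₂) (e : Y → Fin N) (h : Fin M₁ × Fin M₂ → A)
      (g : Fin M₁ × Fin M₂ → Fin N → X × Y), (∀ s, B (h s)) ∧
      ∑ x, ∑ y, (if (x, y) = g (f x) (e y) then 0 else P x * w x (h (f x)) y) ≤
        (∑ x, ∑ a, ∑ y, if T x a y then 0 else P x * k x a * w x a y) / δ +
          Real.exp (-(M₁ / L)) + δ + (L₁ / M₂ + L₂ / N + L₃ / (M₂ * N)) := by
  -- The covering relation cannot mention `y`, which does not exist yet when the action is chosen.
  -- It asks that `y` be atypical with conditional probability at most `δ`.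
  set G : X → A → Prop := fun x a => ∑ y, (if T x a y then 0 else w x a y) ≤ δ with hGdef
  -- As δ < 1, some `y` is typical; hence whatever typicality imposes on (x, a) follows from `G`.
  have hGT : ∀ x a, G x a → ∃ y, T x a y := by
    intro x a hG
    by_contra! hc
    have : ∑ y, (if T x a y then 0 else w x a y) = 1 := by
      rw [← (hw x a).2]
      exact Finset.sum_congr rfl fun y _ => if_neg (hc y)
    simp only [hGdef, this] at hG
    linarith
  obtain ⟨c, hc⟩ := exists_codebook hP hk hL (G := G) (fun x a hG => by
    obtain ⟨y, hy⟩ := hGT x a hG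
    exact (hT x a y hy).1) M₁
  have hGB : ∀ x a, G x a → B a := fun x a hG => by
    obtain ⟨y, hy⟩ := hGT x a hG
    exact (hT x a y hy).2
  -- Codewords violating the constraint are replaced by `a₀`, so every message obeys it. A codeword
  -- that covers some `x` is never replaced.
  set c' : Fin M₁ → A := fun j => if B (c j) then c j else a₀ with hc'
  have hBc' : ∀ j, B (c' j) := fun j => by
    simp only [hc']
    split_ifs with h
    exacts [h, ha₀]
  set J : X → Fin M₁ := fun x => if h : ∃ j, G x (c j) then h.choose else ⟨0, hM₁⟩ with hJ
  have hGJ : ∀ x, (∃ j, G x (c j)) → G x (c' (J x)) := by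
    intro x h
    have hs : G x (c (J x)) := by
      simp only [hJ, dif_pos h]
      exact h.choose_spec
    simp only [hc', if_pos (hGB x _ hs)]
    exact hs
  have hwn : ∀ x a y, 0 ≤ w x a y := fun x a y => (hw x a).1 y
  -- The codebook is fixed before the bins are drawn. Candidates are tested against the codeword of
  -- the true `x`, whether or not they would select it themselves.
  obtain ⟨b, d, hbd⟩ := exists_bins (p := fun x y => P x * w x (c' (J x)) y)
    (fun x y => mul_nonneg (hP.1 x) (hwn _ _ _)) (by
      simp only [← Finset.mul_sum, (hw _ _).2, mul_one]
      exact hP.2) (D := fun x x' y' => T x' (c' (J x)) y') (fun x y => h₁ (c' (J x)) y)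
    (fun x => h₂ x (c' (J x))) (fun x => h₃ (c' (J x))) hM₂ hN
  have hX : Nonempty X := by
    by_contra hX
    rw [not_nonempty_iff] at hX
    simpa using hP.2
  have hY : Nonempty Y := by
    by_contra hY
    rw [not_nonempty_iff] at hY
    simpa using (hw hX.some a₀).2
  set g : Fin M₁ × Fin M₂ → Fin N → X × Y := fun s t =>
    if h : ∃ xy : X × Y, T xy.1 (c' s.1) xy.2 ∧ b xy.1 = s.2 ∧ d xy.2 = t then h.choose
    else (hX.some, hY.some) with hg
  have hdec : ∀ x y, T x (c' (J x)) y → (¬ ∃ x' y', (x', y') ≠ (x, y) ∧ T x' (c' (J x)) y' ∧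
      b x' = b x ∧ d y' = d y) → (x, y) = g (J x, b x) (d y) := by
    intro x y hxy hno
    have hex : ∃ xy : X × Y, T xy.1 (c' (J x)) xy.2 ∧ b xy.1 = b x ∧ d xy.2 = d y :=
      ⟨(x, y), hxy, rfl, rfl⟩
    simp only [hg, dif_pos hex]
    by_contra hne
    exact hno ⟨hex.choose.1, hex.choose.2, fun h => hne h.symm, hex.choose_spec⟩
  refine ⟨fun x => (J x, b x), d, fun s => c' s.1, g, fun s => hBc' _, ?_⟩
  -- An error requires an uncovered `x`, an atypical `y` after good covering, or another typical
  -- pair in the same bins.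
  have hpt : ∀ x y, (if (x, y) = g (J x, b x) (d y) then 0 else P x * w x (c' (J x)) y) ≤
      (if ∃ j, G x (c j) then 0 else P x) * w x (c' (J x)) y +
      P x * (if G x (c' (J x)) then (if T x (c' (J x)) y then 0 else w x (c' (J x)) y) else 0) +
      (if ∃ x' y', (x', y') ≠ (x, y) ∧ T x' (c' (J x)) y' ∧ b x' = b x ∧ d y' = d y
        then P x * w x (c' (J x)) y else 0) := by
    intro x y
    have hpw := mul_nonneg (hP.1 x) (hwn x (c' (J x)) y)
    have e1 : 0 ≤ (if ∃ j, G x (c j) then 0 else P x) * w x (c' (J x)) y := by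
      split_ifs
      exacts [by simp, hpw]
    have e2 : 0 ≤ P x * (if G x (c' (J x)) then
        (if T x (c' (J x)) y then 0 else w x (c' (J x)) y) else 0) := by
      split_ifs
      exacts [by simp, hpw, by simp]
    have e3 : 0 ≤ (if ∃ x' y', (x', y') ≠ (x, y) ∧ T x' (c' (J x)) y' ∧ b x' = b x ∧ d y' = d y
        then P x * w x (c' (J x)) y else 0) := by
      split_ifs
      exacts [hpw, le_rfl]
    by_cases hcor : (x, y) = g (J x, b x) (d y)
    · rw [if_pos hcor]
      exact add_nonneg (add_nonneg e1 e2) e3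
    · rw [if_neg hcor]
      by_cases hj : ∃ j, G x (c j)
      · by_cases hTx : T x (c' (J x)) y
        · have : ∃ x' y', (x', y') ≠ (x, y) ∧ T x' (c' (J x)) y' ∧ b x' = b x ∧ d y' = d y := by
            by_contra hno
            exact hcor (hdec x y hTx hno)
          rw [if_pos this]
          linarith
        · rw [if_pos (hGJ x hj), if_neg hTx]
          linarith
      · rw [if_neg hj]
        linarith
  refine (Finset.sum_le_sum fun x _ => Finset.sum_le_sum fun y _ => hpt x y).trans ?_
  simp only [Finset.sum_add_distrib]
  refine add_le_add (add_le_add ?_ ?_) hbd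
  · simp only [← Finset.mul_sum, (hw _ _).2, mul_one]
    refine hc.trans (add_le_add_left ?_ _)
    rw [Finset.sum_div]
    refine Finset.sum_le_sum fun x _ => ?_
    rw [Finset.sum_div]
    refine Finset.sum_le_sum fun a _ => ?_
    have hpk := mul_nonneg (hP.1 x) ((hk x).1 a)
    have hsum : ∑ y, (if T x a y then 0 else P x * k x a * w x a y) =
        P x * k x a * ∑ y, (if T x a y then 0 else w x a y) := by
      rw [Finset.mul_sum]
      exact Finset.sum_congr rfl fun y _ => by split_ifs <;> simp
    rw [hsum]
    have hnn : 0 ≤ ∑ y, (if T x a y then 0 else w x a y) := Finset.sum_nonneg fun y _ => by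
      split_ifs
      exacts [le_rfl, hwn _ _ _]
    -- Markov's inequality: outside `G` the conditional mass of atypical `y` exceeds `δ`.
    split_ifs with hG
    · exact div_nonneg (mul_nonneg hpk hnn) hδ.le
    · rw [le_div_iff₀ hδ]
      exact mul_le_mul_of_nonneg_left (not_le.1 hG).le hpk
  · calc _ ≤ ∑ x, P x * δ := by
          refine Finset.sum_le_sum fun x _ => ?_
          rw [← Finset.mul_sum]
          refine mul_le_mul_of_nonneg_left ?_ (hP.1 x)
          by_cases hG : G x (c' (J x))
          · simp only [if_pos hG]
            exact hG
          · simp only [if_neg hG, Finset.sum_const_zero]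
            exact hδ.le
      _ = δ := by rw [← Finset.sum_mul, hP.2, one_mul]

/-! Achievability for memoryless sources. -/

/-- Rounding a codebook size down loses at most a factor two, which the exponential slack absorbs.
-/
theorem half_le_natFloor {x : ℝ} (hx : 1 ≤ x) : x / 2 ≤ (⌊x⌋₊ : ℝ) := by
  have h1 := Nat.lt_floor_add_one x
  have h2 : (1 : ℝ) ≤ (⌊x⌋₊ : ℝ) := by exact_mod_cast (Nat.one_le_floor_iff x).2 hx
  linarith

theorem one_le_exp_nat_mul {r : ℝ} (hr : 0 ≤ r) (n : ℕ) : 1 ≤ Real.exp (n * r) :=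
  Real.one_le_exp (by positivity)

theorem tendsto_exp_nat_mul_of_neg {s : ℝ} (hs : s < 0) :
    Filter.Tendsto (fun n : ℕ => Real.exp (n * s)) Filter.atTop (𝓝 0) :=
  Real.tendsto_exp_atBot.comp (tendsto_natCast_atTop_atTop.atTop_mul_const_of_neg hs)

theorem tendsto_exp_div_natFloor {t r : ℝ} (htr : t < r) (hr : 0 ≤ r) :
    Filter.Tendsto (fun n : ℕ => Real.exp (n * t) / (⌊Real.exp (n * r)⌋₊ : ℝ))
      Filter.atTop (𝓝 0) := by
  have hlim := (tendsto_exp_nat_mul_of_neg (sub_neg.2 htr)).const_mul 2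
  rw [mul_zero] at hlim
  refine squeeze_zero (fun n => by positivity) (fun n => ?_) hlim
  have h1 := half_le_natFloor (one_le_exp_nat_mul hr n)
  have h2 := Real.exp_pos (n * r)
  calc Real.exp (n * t) / (⌊Real.exp (n * r)⌋₊ : ℝ) ≤ Real.exp (n * t) / (Real.exp (n * r) / 2) :=
        div_le_div_of_nonneg_left (Real.exp_pos _).le (by positivity) h1
    _ = 2 * Real.exp (n * (t - r)) := by
        rw [mul_sub, Real.exp_sub]
        field_simp

theorem tendsto_exp_div_natFloor_mul {t r s : ℝ} (htr : t < r + s) (hr : 0 ≤ r) (hs : 0 ≤ s) :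
    Filter.Tendsto (fun n : ℕ => Real.exp (n * t) /
      ((⌊Real.exp (n * r)⌋₊ : ℝ) * (⌊Real.exp (n * s)⌋₊ : ℝ))) Filter.atTop (𝓝 0) := by
  have hlim := (tendsto_exp_nat_mul_of_neg (sub_neg.2 htr)).const_mul 4
  rw [mul_zero] at hlim
  refine squeeze_zero (fun n => by positivity) (fun n => ?_) hlim
  have h1 := half_le_natFloor (one_le_exp_nat_mul hr n)
  have h1' := half_le_natFloor (one_le_exp_nat_mul hs n)
  have h2 := Real.exp_pos (n * r)
  have h2' := Real.exp_pos (n * s)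
  calc _ ≤ Real.exp (n * t) / ((Real.exp (n * r) / 2) * (Real.exp (n * s) / 2)) :=
        div_le_div_of_nonneg_left (Real.exp_pos _).le (by positivity)
          (mul_le_mul h1 h1' (by positivity) (by positivity))
    _ = 4 * Real.exp (n * (t - (r + s))) := by
        rw [mul_sub, Real.exp_sub, mul_add, Real.exp_add]
        field_simp
        norm_num

theorem tendsto_exp_neg_natFloor_div {t r : ℝ} (htr : t < r) (hr : 0 ≤ r) :
    Filter.Tendsto (fun n : ℕ => Real.exp (-((⌊Real.exp (n * r)⌋₊ : ℝ) / Real.exp (n * t))))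
      Filter.atTop (𝓝 0) := by
  refine Real.tendsto_exp_neg_atTop_nhds_zero.comp ?_
  have hlim : Filter.Tendsto (fun n : ℕ => Real.exp (n * (r - t)) / 2) Filter.atTop
      Filter.atTop := (Real.tendsto_exp_atTop.comp
    (tendsto_natCast_atTop_atTop.atTop_mul_const (sub_pos.2 htr))).atTop_div_const two_pos
  refine Filter.tendsto_atTop_mono (fun n => ?_) hlim
  have h1 := half_le_natFloor (one_le_exp_nat_mul hr n)
  have h2 := Real.exp_pos (n * t)
  rw [mul_sub, Real.exp_sub, div_div, mul_comm (Real.exp (n * t)), ← div_div]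
  exact div_le_div_of_nonneg_right h1 h2.le

/-- Turns a typicality threshold into a count: a typical sequence has weight at least exp(-s), so
sequences can be counted by summing weights. -/
theorem one_le_exp_mul_prod {ι : Type*} [Fintype ι] {u : ι → ℝ} (hu : ∀ i, 0 < u i) {s : ℝ}
    (h : ∑ i, -Real.log (u i) ≤ s) : 1 ≤ Real.exp s * ∏ i, u i := by
  have h1 : ∏ i, u i = Real.exp (∑ i, Real.log (u i)) := by
    rw [Real.exp_sum]
    exact Finset.prod_congr rfl fun i _ => (Real.exp_log (hu i)).symm
  rw [h1, ← Real.exp_add]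
  rw [Finset.sum_neg_distrib] at h
  exact Real.one_le_exp (by linarith)

theorem prod_le_exp {ι : Type*} [Fintype ι] {u : ι → ℝ} (hu : ∀ i, 0 < u i) {s : ℝ}
    (h : ∑ i, Real.log (u i) ≤ s) : ∏ i, u i ≤ Real.exp s := by
  have h1 : ∏ i, u i = Real.exp (∑ i, Real.log (u i)) := by
    rw [Real.exp_sum]
    exact Finset.prod_congr rfl fun i _ => (Real.exp_log (hu i)).symm
  rw [h1]
  exact Real.exp_le_exp.2 h

theorem sum_triple {X A Y : Type*} [Fintype X] [Fintype A] [Fintype Y] {n : ℕ}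
    (F : (Fin n → X) → (Fin n → A) → (Fin n → Y) → ℝ) :
    ∑ ω : Fin n → X × A × Y, F (fun i => (ω i).1) (fun i => (ω i).2.1) (fun i => (ω i).2.2) =
      ∑ x, ∑ a, ∑ y, F x a y := by
  let e : (Fin n → X × A × Y) ≃ (Fin n → X) × (Fin n → A) × (Fin n → Y) :=
    { toFun := fun ω => (fun i => (ω i).1, fun i => (ω i).2.1, fun i => (ω i).2.2)
      invFun := fun t i => (t.1 i, t.2.1 i, t.2.2 i)
      left_inv := fun _ => rfl
      right_inv := fun _ => rfl }
  have h := Fintype.sum_equiv e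
    (fun ω => F (fun i => (ω i).1) (fun i => (ω i).2.1) fun i => (ω i).2.2)
    (fun t => F t.1 t.2.1 t.2.2) fun _ => rfl
  rw [h]
  simp only [Fintype.sum_prod_type]

/-! ### Typical sequences of a memoryless source. -/

section Block

set_option linter.unusedSectionVars false

variable {X A Y : Type*} [Fintype X] [Fintype A] [Fintype Y]
  {P : X → ℝ} {k : X → A → ℝ} {w : X → A → Y → ℝ}

/-- The joint typicality relation: the normalized information densities do not exceed the
thresholds `s`, `t₁`, `t₂`, `t₃` and the cost does not exceed `Γ`. -/
def Typical (P : X → ℝ) (k : X → A → ℝ) (w : X → A → Y → ℝ) (Λ : A → ℝ) (s t₁ t₂ t₃ Γ : ℝ)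
    {n : ℕ} (x : Fin n → X) (a : Fin n → A) (y : Fin n → Y) : Prop :=
  -- Without positivity, the convention `Real.log 0 = 0` could let impossible sequences meet the
  -- thresholds.
  (∀ i, 0 < P (x i) * k (x i) (a i) * w (x i) (a i) (y i)) ∧
  ∑ i, Real.log (k (x i) (a i) / margA P k (a i)) ≤ n * s ∧
  ∑ i, -Real.log (P (x i) * k (x i) (a i) * w (x i) (a i) (y i) /
    margAY P k w (a i) (y i)) ≤ n * t₁ ∧
  ∑ i, -Real.log (w (x i) (a i) (y i)) ≤ n * t₂ ∧
  ∑ i, -Real.log (P (x i) * k (x i) (a i) * w (x i) (a i) (y i) / margA P k (a i)) ≤ n * t₃ ∧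
  ∑ i, Λ (a i) ≤ n * Γ

theorem joint_mem_stdSimplex (hP : P ∈ stdSimplex ℝ X) (hk : ∀ x, k x ∈ stdSimplex ℝ A)
    (hw : ∀ x a, w x a ∈ stdSimplex ℝ Y) :
    (fun ω : X × A × Y => P ω.1 * k ω.1 ω.2.1 * w ω.1 ω.2.1 ω.2.2) ∈
      stdSimplex ℝ (X × A × Y) := by
  refine ⟨fun ω => mul_nonneg (mul_nonneg (hP.1 _) ((hk _).1 _)) ((hw _ _).1 _), ?_⟩
  simp only [Fintype.sum_prod_type, ← Finset.mul_sum, (hw _ _).2, mul_one, (hk _).2]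
  exact hP.2

theorem sum_joint_mul (φ : X → A → Y → ℝ) :
    ∑ ω : X × A × Y, P ω.1 * k ω.1 ω.2.1 * w ω.1 ω.2.1 ω.2.2 * φ ω.1 ω.2.1 ω.2.2 =
      avg P k w φ := by
  simp only [Fintype.sum_prod_type, avg]

open Classical in
/-- The cost exceeds `Γ` with vanishing probability, if it does so in the mean strictly or if no
action that is used costs more. -/
theorem tendsto_cost_tail (hP : P ∈ stdSimplex ℝ X) (hk : ∀ x, k x ∈ stdSimplex ℝ A)
    (hw : ∀ x a, w x a ∈ stdSimplex ℝ Y) {Λ : A → ℝ} {Γ : ℝ}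
    (h : ∑ x, ∑ a, P x * k x a * Λ a < Γ ∨ ∀ a, 0 < margA P k a → Λ a ≤ Γ) :
    Filter.Tendsto (fun n : ℕ => ∑ ω : Fin n → X × A × Y,
      if n * Γ < ∑ i, Λ (ω i).2.1 then
        ∏ i, (P (ω i).1 * k (ω i).1 (ω i).2.1 * w (ω i).1 (ω i).2.1 (ω i).2.2) else 0)
      Filter.atTop (𝓝 0) := by
  rcases h with h | h
  · refine tendsto_sum_tail (joint_mem_stdSimplex hP hk hw) (φ := fun ω => Λ ω.2.1) ?_
    have := sum_joint_mul (P := P) (k := k) (w := w) fun _ a _ => Λ a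
    rw [this, avg_fst_snd (fun x a => (hw x a).2) fun _ a => Λ a]
    exact h
  -- Every sequence of positive probability uses only actions of cost at most `Γ`, so the event has
  -- probability zero.
  · refine tendsto_const_nhds.congr fun n => ?_
    symm
    refine Finset.sum_eq_zero fun ω _ => ?_
    split_ifs with hlt
    · by_contra hne
      rw [← ne_eq, Finset.prod_ne_zero_iff] at hne
      refine absurd hlt (not_lt.2 ?_)
      have : ∀ i ∈ Finset.univ, Λ (ω i).2.1 ≤ Γ := by
        intro i hi
        refine h _ (lt_of_lt_of_le ?_ (le_margA hP.1 (fun x a => (hk x).1 a) (ω i).1 _))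
        exact (mul_nonneg (hP.1 _) ((hk _).1 _)).lt_of_ne' (left_ne_zero_of_mul (hne i hi))
      refine (Finset.sum_le_sum this).trans ?_
      simp
    · rfl

open Classical in
-- Union bound over the five thresholds, each exceeded with vanishing probability; sequences off the
-- support carry no mass.
theorem tendsto_atypical (hP : P ∈ stdSimplex ℝ X) (hk : ∀ x, k x ∈ stdSimplex ℝ A)
    (hw : ∀ x a, w x a ∈ stdSimplex ℝ Y) {Λ : A → ℝ} {s t₁ t₂ t₃ Γ : ℝ}
    (hs : avg P k w (fun x a _ => Real.log (k x a / margA P k a)) < s)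
    (h₁ : avg P k w (fun x a y => -Real.log (P x * k x a * w x a y / margAY P k w a y)) < t₁)
    (h₂ : avg P k w (fun x a y => -Real.log (w x a y)) < t₂)
    (h₃ : avg P k w (fun x a y => -Real.log (P x * k x a * w x a y / margA P k a)) < t₃)
    (hΓ : ∑ x, ∑ a, P x * k x a * Λ a < Γ ∨ ∀ a, 0 < margA P k a → Λ a ≤ Γ) :
    Filter.Tendsto (fun n : ℕ => ∑ x : Fin n → X, ∑ a : Fin n → A, ∑ y : Fin n → Y,
      if Typical P k w Λ s t₁ t₂ t₃ Γ x a y then 0 else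
        (∏ i, P (x i)) * (∏ i, k (x i) (a i)) * ∏ i, w (x i) (a i) (y i))
      Filter.atTop (𝓝 0) := by
  have hj := joint_mem_stdSimplex hP hk hw
  have T₀ := tendsto_sum_tail hj (φ := fun ω => Real.log (k ω.1 ω.2.1 / margA P k ω.2.1))
    ((sum_joint_mul fun x a _ => Real.log (k x a / margA P k a)).trans_lt hs)
  have T₁ := tendsto_sum_tail hj (φ := fun ω => -Real.log (P ω.1 * k ω.1 ω.2.1 *
      w ω.1 ω.2.1 ω.2.2 / margAY P k w ω.2.1 ω.2.2)) ((sum_joint_mul fun x a y =>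
    -Real.log (P x * k x a * w x a y / margAY P k w a y)).trans_lt h₁)
  have T₂ := tendsto_sum_tail hj (φ := fun ω => -Real.log (w ω.1 ω.2.1 ω.2.2))
    ((sum_joint_mul fun x a y => -Real.log (w x a y)).trans_lt h₂)
  have T₃ := tendsto_sum_tail hj (φ := fun ω => -Real.log (P ω.1 * k ω.1 ω.2.1 *
      w ω.1 ω.2.1 ω.2.2 / margA P k ω.2.1)) ((sum_joint_mul fun x a y =>
    -Real.log (P x * k x a * w x a y / margA P k a)).trans_lt h₃)
  have T₄ := tendsto_cost_tail hP hk hw hΓ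
  have hsum := (((T₀.add T₁).add T₂).add T₃).add T₄
  simp only [add_zero] at hsum
  refine squeeze_zero (fun n => ?_) (fun n => ?_) hsum
  · refine Finset.sum_nonneg fun x _ => Finset.sum_nonneg fun a _ => Finset.sum_nonneg fun y _ => ?_
    split_ifs
    · exact le_rfl
    · exact mul_nonneg (mul_nonneg (Finset.prod_nonneg fun i _ => hP.1 _)
        (Finset.prod_nonneg fun i _ => (hk _).1 _)) (Finset.prod_nonneg fun i _ => (hw _ _).1 _)
  · rw [← sum_triple fun x a y => if Typical P k w Λ s t₁ t₂ t₃ Γ x a y then 0 else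
        (∏ i, P (x i)) * (∏ i, k (x i) (a i)) * ∏ i, w (x i) (a i) (y i)]
    simp only [← Finset.sum_add_distrib]
    refine Finset.sum_le_sum fun ω _ => ?_
    rw [← Finset.prod_mul_distrib, ← Finset.prod_mul_distrib]
    set p := ∏ i, (P (ω i).1 * k (ω i).1 (ω i).2.1 * w (ω i).1 (ω i).2.1 (ω i).2.2) with hp
    have hp0 : 0 ≤ p := Finset.prod_nonneg fun i _ => hj.1 (ω i)
    have hite : ∀ c : Prop, 0 ≤ if c then p else 0 := fun c => by
      split_ifs
      exacts [hp0, le_rfl]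
    by_cases hT : Typical P k w Λ s t₁ t₂ t₃ Γ (fun i => (ω i).1) (fun i => (ω i).2.1)
        fun i => (ω i).2.2
    · rw [if_pos hT]
      exact add_nonneg (add_nonneg (add_nonneg (add_nonneg (hite _) (hite _)) (hite _)) (hite _))
        (hite _)
    rw [if_neg hT]
    rcases hp0.eq_or_lt with hz | hpos
    · simp [← hz]
    have hall : ∀ i, 0 < P (ω i).1 * k (ω i).1 (ω i).2.1 * w (ω i).1 (ω i).2.1 (ω i).2.2 := by
      intro i
      exact (hj.1 (ω i)).lt_of_ne' (Finset.prod_ne_zero_iff.1 hpos.ne' i (Finset.mem_univ i))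
    by_contra! hlt
    apply hT
    refine ⟨hall, ?_, ?_, ?_, ?_, ?_⟩ <;>
    · by_contra! hc
      rw [if_pos hc] at hlt
      linarith [hite (n * s < ∑ i, Real.log (k (ω i).1 (ω i).2.1 / margA P k (ω i).2.1)),
        hite (n * t₁ < ∑ i, -Real.log (P (ω i).1 * k (ω i).1 (ω i).2.1 *
          w (ω i).1 (ω i).2.1 (ω i).2.2 / margAY P k w (ω i).2.1 (ω i).2.2)),
        hite (n * t₂ < ∑ i, -Real.log (w (ω i).1 (ω i).2.1 (ω i).2.2)),
        hite (n * t₃ < ∑ i, -Real.log (P (ω i).1 * k (ω i).1 (ω i).2.1 *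
          w (ω i).1 (ω i).2.1 (ω i).2.2 / margA P k (ω i).2.1)),
        hite (n * Γ < ∑ i, Λ (ω i).2.1)]

theorem margA_prod {n : ℕ} (a : Fin n → A) :
    margA (fun x : Fin n → X => ∏ i, P (x i)) (fun x a => ∏ i, k (x i) (a i)) a =
      ∏ i, margA P k (a i) := by
  simp only [margA, ← Finset.prod_mul_distrib]
  exact sum_prod_pi fun i x => P x * k x (a i)

/-! ### Sizes of typical sets. -/

section Counting

variable {Λ : A → ℝ} {s t₁ t₂ t₃ Γ : ℝ} {n : ℕ}

theorem Typical.pos (hP : P ∈ stdSimplex ℝ X) (hk : ∀ x, k x ∈ stdSimplex ℝ A)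
    (hw : ∀ x a, w x a ∈ stdSimplex ℝ Y) {x : Fin n → X} {a : Fin n → A} {y : Fin n → Y}
    (h : Typical P k w Λ s t₁ t₂ t₃ Γ x a y) (i : Fin n) :
    0 < P (x i) ∧ 0 < k (x i) (a i) ∧ 0 < w (x i) (a i) (y i) ∧ 0 < margA P k (a i) ∧
      0 < margAY P k w (a i) (y i) := by
  have h0 := h.1 i
  have hwi := (hw (x i) (a i)).1 (y i)
  have hPk := pos_of_mul_pos_left h0 hwi
  have hmy := h0.trans_le (le_margAY hP.1 (fun x a => (hk x).1 a) (fun x a y => (hw x a).1 y)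
    (x i) (a i) (y i))
  exact ⟨pos_of_mul_pos_left hPk ((hk _).1 _), pos_of_mul_pos_right hPk (hP.1 _),
    pos_of_mul_pos_right h0 hPk.le, hPk.trans_le (le_margA hP.1 (fun x a => (hk x).1 a) _ _), hmy⟩

/-- The change-of-measure constant required by covering, with exponent close to I(X;A). -/
theorem Typical.kernel_le (hP : P ∈ stdSimplex ℝ X) (hk : ∀ x, k x ∈ stdSimplex ℝ A)
    (hw : ∀ x a, w x a ∈ stdSimplex ℝ Y) {x : Fin n → X} {a : Fin n → A} {y : Fin n → Y}
    (h : Typical P k w Λ s t₁ t₂ t₃ Γ x a y) :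
    ∏ i, k (x i) (a i) ≤ Real.exp (n * s) *
      margA (fun x : Fin n → X => ∏ i, P (x i)) (fun x a => ∏ i, k (x i) (a i)) a := by
  have hpos := Typical.pos hP hk hw h
  have := prod_le_exp (fun i => div_pos (hpos i).2.1 (hpos i).2.2.2.1) h.2.1
  rw [Finset.prod_div_distrib, div_le_iff₀ (Finset.prod_pos fun i _ => (hpos i).2.2.2.1)] at this
  rwa [margA_prod]

open Classical in
-- Counted with the weights P(x|a,y), which sum to at most 1.
theorem sum_typical_fst_le (hP : P ∈ stdSimplex ℝ X) (hk : ∀ x, k x ∈ stdSimplex ℝ A)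
    (hw : ∀ x a, w x a ∈ stdSimplex ℝ Y) (a : Fin n → A) (y : Fin n → Y) :
    ∑ x : Fin n → X, (if Typical P k w Λ s t₁ t₂ t₃ Γ x a y then (1 : ℝ) else 0) ≤
      Real.exp (n * t₁) := by
  have hk0 := fun x a => (hk x).1 a
  have hw0 := fun x a y => (hw x a).1 y
  have hnn : ∀ x b z, 0 ≤ P x * k x b * w x b z / margAY P k w b z := fun x b z =>
    div_nonneg (mul_nonneg (mul_nonneg (hP.1 x) (hk0 _ _)) (hw0 _ _ _))
      (margAY_nonneg hP.1 hk0 hw0 _ _)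
  calc _ ≤ ∑ x : Fin n → X, Real.exp (n * t₁) * ∏ i, (P (x i) * k (x i) (a i) *
        w (x i) (a i) (y i) / margAY P k w (a i) (y i)) := by
        refine Finset.sum_le_sum fun x _ => ?_
        split_ifs with h
        · exact one_le_exp_mul_prod
            (fun i => div_pos (h.1 i) (Typical.pos hP hk hw h i).2.2.2.2) h.2.2.1
        · exact mul_nonneg (Real.exp_pos _).le (Finset.prod_nonneg fun i _ => hnn _ _ _)
    _ ≤ Real.exp (n * t₁) := by
        rw [← Finset.mul_sum,
          sum_prod_pi fun i x => P x * k x (a i) * w x (a i) (y i) / margAY P k w (a i) (y i)]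
        refine mul_le_of_le_one_right (Real.exp_pos _).le
          (Finset.prod_le_one (fun i _ => Finset.sum_nonneg fun x _ => hnn _ _ _) fun i _ => ?_)
        rw [← Finset.sum_div]
        exact div_self_le_one _

open Classical in
theorem sum_typical_snd_le (hP : P ∈ stdSimplex ℝ X) (hk : ∀ x, k x ∈ stdSimplex ℝ A)
    (hw : ∀ x a, w x a ∈ stdSimplex ℝ Y) (x : Fin n → X) (a : Fin n → A) :
    ∑ y : Fin n → Y, (if Typical P k w Λ s t₁ t₂ t₃ Γ x a y then (1 : ℝ) else 0) ≤
      Real.exp (n * t₂) := by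
  calc _ ≤ ∑ y : Fin n → Y, Real.exp (n * t₂) * ∏ i, w (x i) (a i) (y i) := by
        refine Finset.sum_le_sum fun y _ => ?_
        split_ifs with h
        · exact one_le_exp_mul_prod (fun i => (Typical.pos hP hk hw h i).2.2.1) h.2.2.2.1
        · exact mul_nonneg (Real.exp_pos _).le (Finset.prod_nonneg fun i _ => (hw _ _).1 _)
    _ = Real.exp (n * t₂) := by
        rw [← Finset.mul_sum, sum_prod_eq_one (f := fun i => w (x i) (a i))
          fun i => (hw (x i) (a i)).2, mul_one]

open Classical in
-- Counted with the weights P(x|a) P(y|x,a).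
theorem sum_typical_le (hP : P ∈ stdSimplex ℝ X) (hk : ∀ x, k x ∈ stdSimplex ℝ A)
    (hw : ∀ x a, w x a ∈ stdSimplex ℝ Y) (a : Fin n → A) :
    ∑ x : Fin n → X, ∑ y : Fin n → Y,
      (if Typical P k w Λ s t₁ t₂ t₃ Γ x a y then (1 : ℝ) else 0) ≤ Real.exp (n * t₃) := by
  have hk0 := fun x a => (hk x).1 a
  have hnn : ∀ x b, 0 ≤ P x * k x b / margA P k b := fun x b =>
    div_nonneg (mul_nonneg (hP.1 x) (hk0 _ _)) (margA_nonneg hP.1 hk0 _)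
  calc _ ≤ ∑ x : Fin n → X, ∑ y : Fin n → Y, Real.exp (n * t₃) *
        ((∏ i, P (x i) * k (x i) (a i) / margA P k (a i)) * ∏ i, w (x i) (a i) (y i)) := by
        refine Finset.sum_le_sum fun x _ => Finset.sum_le_sum fun y _ => ?_
        split_ifs with h
        · refine (one_le_exp_mul_prod
            (fun i => div_pos (h.1 i) (Typical.pos hP hk hw h i).2.2.2.1)
            h.2.2.2.2.1).trans (le_of_eq ?_)
          rw [← Finset.prod_mul_distrib]
          congr 1
          exact Finset.prod_congr rfl fun i _ => by ring
        · exact mul_nonneg (Real.exp_pos _).le (mul_nonneg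
            (Finset.prod_nonneg fun i _ => hnn _ _) (Finset.prod_nonneg fun i _ => (hw _ _).1 _))
    _ = ∑ x : Fin n → X, Real.exp (n * t₃) * ∏ i, P (x i) * k (x i) (a i) / margA P k (a i) := by
        refine Finset.sum_congr rfl fun x _ => ?_
        rw [← Finset.mul_sum, ← Finset.mul_sum, sum_prod_eq_one (f := fun i => w (x i) (a i))
          fun i => (hw (x i) (a i)).2, mul_one]
    _ ≤ Real.exp (n * t₃) := by
        rw [← Finset.mul_sum, sum_prod_pi fun i x => P x * k x (a i) / margA P k (a i)]
        refine mul_le_of_le_one_right (Real.exp_pos _).le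
          (Finset.prod_le_one (fun i _ => Finset.sum_nonneg fun x _ => hnn _ _) fun i _ => ?_)
        rw [← Finset.sum_div]
        exact div_self_le_one _

end Counting

end Block

/-! ### From typical sets to sequences of codes. -/

section Achievability

set_option linter.unusedSectionVars false

variable {X A Y : Type*} [Fintype X] [Fintype A] [Fintype Y]

/-- Nonnegativity of I(X;A): the Gibbs inequality against the product of the marginals. -/
theorem avg_log_kernel_nonneg {P : X → ℝ} {k : X → A → ℝ} {w : X → A → Y → ℝ}
    (hP : P ∈ stdSimplex ℝ X) (hk : ∀ x, k x ∈ stdSimplex ℝ A)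
    (hw : ∀ x a, w x a ∈ stdSimplex ℝ Y) :
    0 ≤ avg P k w (fun x a _ => Real.log (k x a / margA P k a)) := by
  rw [avg_fst_snd (fun x a => (hw x a).2) fun x a => Real.log (k x a / margA P k a)]
  have hk0 := fun x a => (hk x).1 a
  have hm := margA_nonneg hP.1 hk0
  have hle := le_margA hP.1 hk0
  have hg := sum_mul_log_le (Ω := X × A) (p := fun ω => P ω.1 * k ω.1 ω.2)
    (q := fun ω => P ω.1 * margA P k ω.2)
    ⟨fun ω => mul_nonneg (hP.1 _) (hk0 _ _), by
      simp only [Fintype.sum_prod_type, ← Finset.mul_sum, (hk _).2, mul_one]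
      exact hP.2⟩
    (by
      simp only [Fintype.sum_prod_type, ← Finset.mul_sum, sum_margA fun x => (hk x).2, hP.2,
        mul_one]
      exact le_rfl)
    (fun ω => mul_nonneg (hP.1 _) (hm _))
    (fun ω h => mul_pos (pos_of_mul_pos_left h (hk0 _ _)) (h.trans_le (hle _ _)))
  simp only [Fintype.sum_prod_type] at hg
  rw [← sub_nonneg] at hg
  refine hg.trans (le_of_eq ?_)
  simp only [← Finset.sum_sub_distrib]
  refine Finset.sum_congr rfl fun x _ => Finset.sum_congr rfl fun a _ => ?_
  rcases (hP.1 x).eq_or_lt with h1 | h1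
  · simp [← h1]
  rcases (hk0 x a).eq_or_lt with h2 | h2
  · simp [← h2]
  have h3 := (mul_pos h1 h2).trans_le (hle x a)
  rw [Real.log_mul h1.ne' h2.ne', Real.log_mul h1.ne' h3.ne', Real.log_div h2.ne' h3.ne']
  ring

theorem avg_nonneg {P : X → ℝ} {k : X → A → ℝ} {w : X → A → Y → ℝ}
    (hP : ∀ x, 0 ≤ P x) (hk : ∀ x a, 0 ≤ k x a) (hw : ∀ x a y, 0 ≤ w x a y)
    {φ : X → A → Y → ℝ} (hφ : ∀ x a y, 0 ≤ φ x a y) : 0 ≤ avg P k w φ :=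
  Finset.sum_nonneg fun x _ => Finset.sum_nonneg fun a _ => Finset.sum_nonneg fun y _ =>
    mul_nonneg (mul_nonneg (mul_nonneg (hP x) (hk x a)) (hw x a y)) (hφ x a y)

/-- Splits the first rate into its covering part I(X;A) and its binning part H(X|Y,A). -/
theorem rateX_eq_add {P : X → ℝ} {k : X → A → ℝ} {w : X → A → Y → ℝ}
    (hP : P ∈ stdSimplex ℝ X) (hk : ∀ x, k x ∈ stdSimplex ℝ A)
    (hw : ∀ x a, w x a ∈ stdSimplex ℝ Y) :
    rateX P k w = avg P k w (fun x a _ => Real.log (k x a / margA P k a)) +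
      avg P k w (fun x a y => -Real.log (P x * k x a * w x a y / margAY P k w a y)) := by
  have hk0 := fun x a => (hk x).1 a
  have hw0 := fun x a y => (hw x a).1 y
  rw [rateX, ← avg_add]
  refine avg_congr hP.1 hk0 hw0 fun x a y h1 h2 h3 => ?_
  have h4 := (mul_pos h1 h2).trans_le (le_margA hP.1 hk0 x a)
  have h5 := (mul_pos (mul_pos h1 h2) h3).trans_le (le_margAY hP.1 hk0 hw0 x a y)
  rw [Real.log_div (by positivity) h5.ne', Real.log_div h2.ne' h4.ne',
    Real.log_div h5.ne' h4.ne', Real.log_mul (by positivity) h3.ne', Real.log_mul h1.ne' h2.ne']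
  ring

theorem rateSum_eq_add {P : X → ℝ} {k : X → A → ℝ} {w : X → A → Y → ℝ}
    (hP : P ∈ stdSimplex ℝ X) (hk : ∀ x, k x ∈ stdSimplex ℝ A)
    (hw : ∀ x a, w x a ∈ stdSimplex ℝ Y) :
    rateSum P k w = avg P k w (fun x a _ => Real.log (k x a / margA P k a)) +
      avg P k w (fun x a y => -Real.log (P x * k x a * w x a y / margA P k a)) := by
  have hk0 := fun x a => (hk x).1 a
  have hw0 := fun x a y => (hw x a).1 y
  rw [rateSum, ← avg_add]
  refine avg_congr hP.1 hk0 hw0 fun x a y h1 h2 h3 => ?_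
  have h4 := (mul_pos h1 h2).trans_le (le_margA hP.1 hk0 x a)
  rw [Real.log_div h2.ne' h4.ne', Real.log_div (by positivity) h4.ne',
    Real.log_mul (by positivity) h3.ne', Real.log_mul h1.ne' h2.ne']
  ring

theorem le_one_of_mem_stdSimplex {Ω : Type*} [Fintype Ω] {p : Ω → ℝ} (hp : p ∈ stdSimplex ℝ Ω)
    (ω : Ω) : p ω ≤ 1 := by
  rw [← hp.2]
  exact Finset.single_le_sum (fun ω _ => hp.1 ω) (Finset.mem_univ ω)

theorem two_rpow_nat_mul (n : ℕ) (R : ℝ) :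
    (2 : ℝ) ^ ((n : ℝ) * R) = Real.exp (n * (R * Real.log 2)) := by
  rw [Real.rpow_def_of_pos two_pos]
  congr 1
  ring

theorem natFloor_exp_mul_natFloor_exp_le {r s R : ℝ} (h : r + s = R * Real.log 2) (n : ℕ) :
    ⌊Real.exp (n * r)⌋₊ * ⌊Real.exp (n * s)⌋₊ ≤ ⌊(2 : ℝ) ^ ((n : ℝ) * R)⌋₊ := by
  have h1 : (⌊Real.exp (n * r)⌋₊ : ℝ) ≤ Real.exp (n * r) := Nat.floor_le (Real.exp_pos _).le
  have h2 : (⌊Real.exp (n * s)⌋₊ : ℝ) ≤ Real.exp (n * s) := Nat.floor_le (Real.exp_pos _).le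
  refine Nat.le_floor ?_
  rw [Nat.cast_mul, two_rpow_nat_mul, ← h, mul_add, Real.exp_add]
  exact mul_le_mul h1 h2 (Nat.cast_nonneg _) (Real.exp_pos _).le

theorem expectedCost_le {P : PMF X} {Λ : A → ℝ} {Γ RX RY : ℝ} {n : ℕ} (hn : 1 ≤ n)
    {c : Code X A Y n RX RY} (h : ∀ x, ∑ i, Λ (c.actions x i) ≤ n * Γ) :
    c.expectedCost P Λ ≤ Γ := by
  have hP := toReal_mem_stdSimplex P
  have hn0 : (0 : ℝ) < n := by exact_mod_cast hn
  calc c.expectedCost P Λ ≤ ∑ x : Fin n → X, (∏ i, (P (x i)).toReal) * Γ := by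
        refine Finset.sum_le_sum fun x _ => mul_le_mul_of_nonneg_left ?_
          (Finset.prod_nonneg fun i _ => hP.1 _)
        rw [one_div, inv_mul_le_iff₀ hn0]
        exact h x
    _ = Γ := by
        rw [← Finset.sum_mul, sum_prod_eq_one (fun (_ : Fin n) => hP.2), one_mul]

open Classical in
/-- A code whose first message is a pair can be relabelled. -/
theorem exists_code_of_pair {P : PMF X} {W : X → A → PMF Y} {RX RY : ℝ} {n M₁ M₂ : ℕ}
    (hM : M₁ * M₂ ≤ ⌊(2 : ℝ) ^ ((n : ℝ) * RX)⌋₊) (hM₁ : 0 < M₁) (hM₂ : 0 < M₂)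
    (f : (Fin n → X) → Fin M₁ × Fin M₂) (e : (Fin n → Y) → Message n RY)
    (h : Fin M₁ × Fin M₂ → Fin n → A)
    (g : Fin M₁ × Fin M₂ → Message n RY → (Fin n → X) × (Fin n → Y)) :
    ∃ c : Code X A Y n RX RY, (∀ x, c.actions x = h (f x)) ∧
      c.errorProb P W = ∑ x, ∑ y, if (x, y) = g (f x) (e y) then 0 else
        (∏ i, (P (x i)).toReal) * ∏ i, (W (x i) (h (f x) i) (y i)).toReal := by
  have : Nonempty (Fin M₁ × Fin M₂) := ⟨(⟨0, hM₁⟩, ⟨0, hM₂⟩)⟩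
  obtain ⟨ι⟩ : Nonempty ((Fin M₁ × Fin M₂) ↪ Message n RX) :=
    Function.Embedding.nonempty_of_card_le (by simpa using hM)
  have hι : ∀ s, Function.invFun ι (ι s) = s := Function.leftInverse_invFun ι.injective
  refine ⟨⟨fun x => ι (f x), e, fun s => h (Function.invFun ι s),
    fun s => g (Function.invFun ι s)⟩, fun x => ?_, ?_⟩
  · simp only [Code.actions, hι]
  · simp only [Code.errorProb, Code.sourceProb, Code.actions, hι]
    refine Finset.sum_congr rfl fun x _ => Finset.sum_congr rfl fun y _ => ?_
    by_cases hxy : (x, y) = g (f x) (e y)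
    · simp [← hxy]
    · simp [hxy]

open Classical in
/-- The one-shot code for blocks of a memoryless source. -/
theorem exists_block_code {P : X → ℝ} (hP : P ∈ stdSimplex ℝ X) {k : X → A → ℝ}
    (hk : ∀ x, k x ∈ stdSimplex ℝ A) {w : X → A → Y → ℝ} (hw : ∀ x a, w x a ∈ stdSimplex ℝ Y)
    {Λ : A → ℝ} (s t₁ t₂ t₃ : ℝ) {Γ : ℝ} {a₀ : A} (ha₀ : Λ a₀ ≤ Γ) {δ : ℝ} (hδ : 0 < δ)
    (hδ1 : δ < 1) (n : ℕ) {M₁ M₂ N : ℕ} (hM₁ : 0 < M₁) (hM₂ : 0 < M₂) (hN : 0 < N) :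
    ∃ (f : (Fin n → X) → Fin M₁ × Fin M₂) (e : (Fin n → Y) → Fin N)
      (h : Fin M₁ × Fin M₂ → (Fin n → A))
      (g : Fin M₁ × Fin M₂ → Fin N → (Fin n → X) × (Fin n → Y)),
      (∀ m, ∑ i, Λ (h m i) ≤ n * Γ) ∧
      ∑ x, ∑ y, (if (x, y) = g (f x) (e y) then 0 else
        (∏ i, P (x i)) * ∏ i, w (x i) (h (f x) i) (y i)) ≤
        (∑ x : Fin n → X, ∑ a : Fin n → A, ∑ y : Fin n → Y,
          if Typical P k w Λ s t₁ t₂ t₃ Γ x a y then 0 else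
            (∏ i, P (x i)) * (∏ i, k (x i) (a i)) * ∏ i, w (x i) (a i) (y i)) / δ +
          Real.exp (-(M₁ / Real.exp (n * s))) + δ + (Real.exp (n * t₁) / M₂ +
            Real.exp (n * t₂) / N + Real.exp (n * t₃) / (M₂ * N)) := by
  have hPn : (fun x : Fin n → X => ∏ i, P (x i)) ∈ stdSimplex ℝ (Fin n → X) :=
    ⟨fun x => Finset.prod_nonneg fun i _ => hP.1 _, sum_prod_eq_one fun _ => hP.2⟩
  have hkn : ∀ x : Fin n → X, (fun a : Fin n → A => ∏ i, k (x i) (a i)) ∈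
      stdSimplex ℝ (Fin n → A) := fun x =>
    ⟨fun a => Finset.prod_nonneg fun i _ => (hk _).1 _,
      sum_prod_eq_one (f := fun i => k (x i)) fun i => (hk (x i)).2⟩
  have hwn : ∀ (x : Fin n → X) (a : Fin n → A), (fun y : Fin n → Y => ∏ i, w (x i) (a i) (y i)) ∈
      stdSimplex ℝ (Fin n → Y) := fun x a =>
    ⟨fun y => Finset.prod_nonneg fun i _ => (hw _ _).1 _,
      sum_prod_eq_one (f := fun i => w (x i) (a i)) fun i => (hw (x i) (a i)).2⟩
  have hcost : ∑ i : Fin n, Λ ((fun _ => a₀ : Fin n → A) i) ≤ n * Γ :=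
    (Finset.sum_le_sum fun i _ => ha₀).trans (by simp)
  obtain ⟨f, e, h, g, hB, herr⟩ := exists_one_shot_code hPn hkn hwn
    (T := Typical P k w Λ s t₁ t₂ t₃ Γ)
    (B := fun a => ∑ i, Λ (a i) ≤ n * Γ) hcost (Real.exp_pos (n * s)) hδ hδ1
    (fun x a y hT => ⟨Typical.kernel_le hP hk hw hT, hT.2.2.2.2.2⟩)
    (fun a y => sum_typical_fst_le hP hk hw a y) (fun x a => sum_typical_snd_le hP hk hw x a)
    (fun a => sum_typical_le hP hk hw a) hM₁ hM₂ hN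
  refine ⟨f, e, h, g, hB, ?_⟩
  convert herr

theorem eventually_exists_code (P : PMF X) (W : X → A → PMF Y) {Λ : A → ℝ} {k : X → A → ℝ}
    (hk : ∀ x, k x ∈ stdSimplex ℝ A) {RX RY Γ : ℝ}
    (hX : rateX (fun x => (P x).toReal) k (fun x a y => (W x a y).toReal) < RX * Real.log 2)
    (hY : rateY (fun x => (P x).toReal) k (fun x a y => (W x a y).toReal) < RY * Real.log 2)
    (hS : rateSum (fun x => (P x).toReal) k (fun x a y => (W x a y).toReal) <
      (RX + RY) * Real.log 2)
    (hΓ : ∑ x, ∑ a, (P x).toReal * k x a * Λ a < Γ ∨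
      ∀ a, 0 < margA (fun x => (P x).toReal) k a → Λ a ≤ Γ) {a₀ : A} (ha₀ : Λ a₀ ≤ Γ) {ε : ℝ}
    (hε : 0 < ε) :
    ∀ᶠ n : ℕ in Filter.atTop, ∃ c : Code X A Y n RX RY,
      c.expectedCost P Λ ≤ Γ ∧ c.errorProb P W ≤ ε := by
  classical
  have hP := toReal_mem_stdSimplex P
  have hw := fun x a => toReal_mem_stdSimplex (W x a)
  set p : X → ℝ := fun x => (P x).toReal with hp
  set w : X → A → Y → ℝ := fun x a y => (W x a y).toReal with hwdef
  have hk0 := fun x a => (hk x).1 a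
  have hw0 := fun x a y => (hw x a).1 y
  have eX := rateX_eq_add hP hk hw
  have eS := rateSum_eq_add hP hk hw
  have hI0 := avg_log_kernel_nonneg hP hk hw
  have hY0 : 0 ≤ rateY p k w := avg_nonneg hP.1 hk0 hw0 fun x a y =>
    neg_nonneg.2 (Real.log_nonpos (hw0 x a y) (le_one_of_mem_stdSimplex (hw x a) y))
  have hJ0 : 0 ≤ avg p k w
      (fun x a y => -Real.log (p x * k x a * w x a y / margAY p k w a y)) :=
    avg_nonneg hP.1 hk0 hw0 fun x a y => neg_nonneg.2 (Real.log_nonpos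
      (div_nonneg (mul_nonneg (mul_nonneg (hP.1 x) (hk0 x a)) (hw0 x a y))
        (margAY_nonneg hP.1 hk0 hw0 a y))
      (div_le_one_of_le₀ (le_margAY hP.1 hk0 hw0 x a y) (margAY_nonneg hP.1 hk0 hw0 a y)))
  set I := avg p k w (fun x a _ => Real.log (k x a / margA p k a)) with hI
  set J₁ := avg p k w (fun x a y => -Real.log (p x * k x a * w x a y / margAY p k w a y))
    with hJ₁
  set J₃ := avg p k w (fun x a y => -Real.log (p x * k x a * w x a y / margA p k a)) with hJ₃
  -- Of the slack 4η, thresholds exceed their means by η and the covering rate exceeds I(X;A) by 2η;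
  -- this leaves every binning exponent at least η above its threshold.
  obtain ⟨η, hη, hη1, hη2, hη3⟩ : ∃ η : ℝ, 0 < η ∧ rateX p k w + 4 * η ≤ RX * Real.log 2 ∧
      rateY p k w + 4 * η ≤ RY * Real.log 2 ∧
      rateSum p k w + 4 * η ≤ (RX + RY) * Real.log 2 := by
    refine ⟨min (RX * Real.log 2 - rateX p k w) (min (RY * Real.log 2 - rateY p k w)
      ((RX + RY) * Real.log 2 - rateSum p k w)) / 4, ?_, ?_, ?_, ?_⟩
    · have := lt_min (sub_pos.2 hX) (lt_min (sub_pos.2 hY) (sub_pos.2 hS))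
      linarith
    · have := min_le_left (RX * Real.log 2 - rateX p k w) (min (RY * Real.log 2 - rateY p k w)
        ((RX + RY) * Real.log 2 - rateSum p k w))
      linarith
    · have := (min_le_right (RX * Real.log 2 - rateX p k w) (min (RY * Real.log 2 - rateY p k w)
        ((RX + RY) * Real.log 2 - rateSum p k w))).trans (min_le_left _ _)
      linarith
    · have := (min_le_right (RX * Real.log 2 - rateX p k w) (min (RY * Real.log 2 - rateY p k w)
        ((RX + RY) * Real.log 2 - rateSum p k w))).trans (min_le_right _ _)
      linarith
  -- `r₁` and `r₂` divide the first encoder's rate between codeword index and bin; `r₃` is the whole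
  -- rate of the second encoder.
  set r₁ := I + 2 * η with hr₁
  set r₂ := RX * Real.log 2 - I - 2 * η with hr₂
  set r₃ := RY * Real.log 2 with hr₃
  have hr₁0 : 0 ≤ r₁ := by linarith
  have hr₂0 : 0 ≤ r₂ := by linarith
  have hr₃0 : 0 ≤ r₃ := by linarith
  have hS' := tendsto_atypical hP hk hw (Λ := Λ) (s := I + η) (t₁ := J₁ + η)
    (t₂ := rateY p k w + η) (t₃ := J₃ + η) (Γ := Γ) (by linarith) (by linarith)
    (lt_add_of_pos_right _ hη) (by linarith) hΓ
  set δ := min (ε / 2) (1 / 2) with hδ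
  have hδ0 : 0 < δ := lt_min (by linarith) (by norm_num)
  have hδ1 : δ < 1 := (min_le_right _ _).trans_lt (by norm_num)
  have hδε : δ < ε := (min_le_left _ _).trans_lt (by linarith)
  have hlim := (((hS'.div_const δ).add
    (tendsto_exp_neg_natFloor_div (t := I + η) (r := r₁) (by linarith) hr₁0)).add
    (tendsto_const_nhds (x := δ))).add
    (((tendsto_exp_div_natFloor (t := J₁ + η) (r := r₂) (by linarith) hr₂0).add
    (tendsto_exp_div_natFloor (t := rateY p k w + η) (r := r₃) (by linarith) hr₃0)).add
    (tendsto_exp_div_natFloor_mul (t := J₃ + η) (r := r₂) (s := r₃) (by linarith) hr₂0 hr₃0))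
  simp only [zero_div, zero_add, add_zero] at hlim
  filter_upwards [hlim.eventually (gt_mem_nhds hδε), Filter.eventually_ge_atTop 1] with n hn hn1
  have hfl : ∀ {r : ℝ}, 0 ≤ r → 0 < ⌊Real.exp (n * r)⌋₊ := fun hr =>
    Nat.floor_pos.2 (one_le_exp_nat_mul hr n)
  have hM : ⌊Real.exp (n * r₁)⌋₊ * ⌊Real.exp (n * r₂)⌋₊ ≤ ⌊(2 : ℝ) ^ ((n : ℝ) * RX)⌋₊ :=
    natFloor_exp_mul_natFloor_exp_le (by rw [hr₁, hr₂]; ring) n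
  have hN : ⌊(2 : ℝ) ^ ((n : ℝ) * RY)⌋₊ = ⌊Real.exp (n * r₃)⌋₊ := by rw [two_rpow_nat_mul]
  have hN0 : 0 < ⌊(2 : ℝ) ^ ((n : ℝ) * RY)⌋₊ := by
    rw [hN]
    exact hfl hr₃0
  have hM₁ := hfl hr₁0
  have hM₂ := hfl hr₂0
  have hblock := exists_block_code (P := p) hP (k := k) hk (w := w) hw (Λ := Λ) (I + η) (J₁ + η)
    (rateY p k w + η) (J₃ + η) (Γ := Γ) (a₀ := a₀) ha₀ hδ0 hδ1 n hM₁ hM₂ hN0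
  obtain ⟨f, e, h, g, hB, herr⟩ := hblock
  obtain ⟨c, hc, hce⟩ := exists_code_of_pair (P := P) (W := W) hM hM₁ hM₂ f e h g
  refine ⟨c, expectedCost_le hn1 fun x => ?_, ?_⟩
  · rw [hc]
    exact hB _
  · rw [hce]
    rw [hN] at herr
    exact herr.trans hn.le

/-- Good codes exist eventually for each error level, but one sequence must serve all levels. At
each length a code within 1/(n+1) of the least error is chosen. -/
theorem achievable_of_lt (P : PMF X) (W : X → A → PMF Y) {Λ : A → ℝ} {k : X → A → ℝ}
    (hk : ∀ x, k x ∈ stdSimplex ℝ A) {RX RY Γ : ℝ}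
    (hX : rateX (fun x => (P x).toReal) k (fun x a y => (W x a y).toReal) < RX * Real.log 2)
    (hY : rateY (fun x => (P x).toReal) k (fun x a y => (W x a y).toReal) < RY * Real.log 2)
    (hS : rateSum (fun x => (P x).toReal) k (fun x a y => (W x a y).toReal) <
      (RX + RY) * Real.log 2)
    (hΓ : ∑ x, ∑ a, (P x).toReal * k x a * Λ a < Γ ∨
      ∀ a, 0 < margA (fun x => (P x).toReal) k a → Λ a ≤ Γ) {a₀ : A} (ha₀ : Λ a₀ ≤ Γ) :
    Achievable P W Λ Γ RX RY := by
  have hP := toReal_mem_stdSimplex P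
  have hw := fun x a => toReal_mem_stdSimplex (W x a)
  have hk0 := fun x a => (hk x).1 a
  have hw0 := fun x a y => (hw x a).1 y
  obtain ⟨x₀, -⟩ := P.support_nonempty
  obtain ⟨y₀, -⟩ := (W x₀ a₀).support_nonempty
  have hRY : 0 ≤ RY * Real.log 2 := le_trans (avg_nonneg hP.1 hk0 hw0 fun x a y =>
    neg_nonneg.2 (Real.log_nonpos (hw0 x a y) (le_one_of_mem_stdSimplex (hw x a) y))) hY.le
  have hRX : 0 ≤ RX * Real.log 2 := by
    rw [rateX_eq_add hP hk hw] at hX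
    refine le_trans (add_nonneg (avg_log_kernel_nonneg hP hk hw) ?_) hX.le
    exact avg_nonneg hP.1 hk0 hw0 fun x a y => neg_nonneg.2 (Real.log_nonpos
      (div_nonneg (mul_nonneg (mul_nonneg (hP.1 x) (hk0 x a)) (hw0 x a y))
        (margAY_nonneg hP.1 hk0 hw0 a y))
      (div_le_one_of_le₀ (le_margAY hP.1 hk0 hw0 x a y) (margAY_nonneg hP.1 hk0 hw0 a y)))
  have hmsg : ∀ {R : ℝ}, 0 ≤ R * Real.log 2 → ∀ n : ℕ, Nonempty (Message n R) := by
    intro R hR n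
    refine ⟨⟨0, Nat.floor_pos.2 ?_⟩⟩
    rw [two_rpow_nat_mul]
    exact one_le_exp_nat_mul hR n
  -- Length 0 is exempt from the cost bound: the cost there is 0, which may exceed a negative `Γ`.
  -- The constant action `a₀` makes every set nonempty.
  set V : ℕ → Set ℝ := fun n => {e | ∃ c : Code X A Y n RX RY,
    (1 ≤ n → c.expectedCost P Λ ≤ Γ) ∧ c.errorProb P W = e} with hV
  have hVne : ∀ n, (V n).Nonempty := by
    intro n
    obtain ⟨s⟩ := hmsg hRX n
    obtain ⟨t⟩ := hmsg hRY n
    refine ⟨_, ⟨fun _ => s, fun _ => t, fun _ _ => a₀, fun _ _ => (fun _ => x₀, fun _ => y₀)⟩,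
      fun hn => expectedCost_le hn fun x => ?_, rfl⟩
    exact (Finset.sum_le_sum fun i _ => ha₀).trans (by simp)
  have hnn : ∀ n, ∀ c : Code X A Y n RX RY, 0 ≤ c.errorProb P W := fun n c =>
    Finset.sum_nonneg fun x _ => Finset.sum_nonneg fun y _ => by
      split_ifs
      · exact mul_nonneg (Finset.prod_nonneg fun i _ => hP.1 _)
          (Finset.prod_nonneg fun i _ => hw0 _ _ _)
      · exact le_rfl
  have hVbd : ∀ n, BddBelow (V n) := fun n => ⟨0, by
    rintro _ ⟨c, -, rfl⟩
    exact hnn n c⟩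
  have hex : ∀ n : ℕ, ∃ c : Code X A Y n RX RY, (1 ≤ n → c.expectedCost P Λ ≤ Γ) ∧
      c.errorProb P W < sInf (V n) + 1 / ((n : ℝ) + 1) := by
    intro n
    obtain ⟨_, ⟨c, hc, rfl⟩, hlt⟩ := exists_lt_of_csInf_lt (hVne n)
      (lt_add_of_pos_right (sInf (V n)) (Nat.one_div_pos_of_nat (n := n) (α := ℝ)))
    exact ⟨c, hc, hlt⟩
  choose c hc hlt using hex
  refine ⟨c, hc, ?_⟩
  have hinf : Filter.Tendsto (fun n => sInf (V n)) Filter.atTop (𝓝 0) := by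
    refine tendsto_order.2 ⟨fun b hb => Filter.Eventually.of_forall fun n => hb.trans_le ?_,
      fun b hb => ?_⟩
    · refine le_csInf (hVne n) ?_
      rintro _ ⟨c, -, rfl⟩
      exact hnn n c
    · filter_upwards [eventually_exists_code P W hk hX hY hS hΓ ha₀ (half_pos hb)] with n hn
      obtain ⟨c, hc, he⟩ := hn
      exact (csInf_le (hVbd n) ⟨c, fun _ => hc, rfl⟩).trans_lt (by linarith)
  have hlim := hinf.add (tendsto_one_div_add_atTop_nhds_zero_nat (𝕜 := ℝ))
  rw [add_zero] at hlim
  exact squeeze_zero (fun n => hnn n _) (fun n => (hlt n).le) hlim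

/-- Every point of the single-letter region is achievable, at the same cost, after an arbitrarily
small increase of the rates. -/
theorem achievable_of_mem_weightRegion {P : PMF X} {W : X → A → PMF Y} {Λ : A → ℝ} {RX RY Γ : ℝ}
    (h : (RX, RY, Γ) ∈
      weightRegion (fun x => (P x).toReal) (fun x a y => (W x a y).toReal) Λ)
    {ε : ℝ} (hε : 0 < ε) : Achievable P W Λ Γ (RX + ε) (RY + ε) := by
  classical
  have hP := toReal_mem_stdSimplex P
  have hw := fun x a => toReal_mem_stdSimplex (W x a)
  have hlog : 0 < Real.log 2 := Real.log_pos one_lt_two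
  -- With a cheaper action available, a small weight `t` on it makes the mean cost strictly less
  -- than `Γ` while the rates move by less than `ε`.
  by_cases hmin : ∃ a₀, Λ a₀ < Γ
  · obtain ⟨a₀, ha₀⟩ := hmin
    set k₀ : X → A → ℝ := fun _ => Pi.single a₀ 1 with hk₀
    have hk₀s : ∀ x, k₀ x ∈ stdSimplex ℝ A := fun x => single_mem_stdSimplex ℝ a₀
    set p : X → ℝ := fun x => (P x).toReal with hp
    set w : X → A → Y → ℝ := fun x a y => (W x a y).toReal with hwdef
    obtain ⟨B, hB1, hB2, hB3⟩ : ∃ B : ℝ, rateX p k₀ w ≤ B * Real.log 2 ∧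
        rateY p k₀ w ≤ B * Real.log 2 ∧ rateSum p k₀ w ≤ (B + B) * Real.log 2 := by
      refine ⟨(|rateX p k₀ w| + |rateY p k₀ w| + |rateSum p k₀ w|) / Real.log 2, ?_, ?_, ?_⟩
      · rw [div_mul_cancel₀ _ hlog.ne']
        linarith [le_abs_self (rateX p k₀ w), abs_nonneg (rateY p k₀ w),
          abs_nonneg (rateSum p k₀ w)]
      · rw [div_mul_cancel₀ _ hlog.ne']
        linarith [le_abs_self (rateY p k₀ w), abs_nonneg (rateX p k₀ w),
          abs_nonneg (rateSum p k₀ w)]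
      · rw [add_mul, div_mul_cancel₀ _ hlog.ne']
        linarith [le_abs_self (rateSum p k₀ w), abs_nonneg (rateX p k₀ w),
          abs_nonneg (rateY p k₀ w), abs_nonneg (rateSum p k₀ w)]
    have hpt : (B, B, Λ a₀) ∈ weightRegion p w Λ := by
      refine ⟨k₀, hk₀s, hB1, hB2, hB3, le_of_eq ?_⟩
      have : ∀ x, ∑ a, p x * k₀ x a * Λ a = p x * Λ a₀ := by
        intro x
        rw [Finset.sum_eq_single a₀]
        · simp [hk₀]
        · intro a _ ha
          simp [hk₀, ha]
        · simp
      simp only [this]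
      rw [← Finset.sum_mul, hP.2, one_mul]
    obtain ⟨t, ht0, ht1, htX, htY⟩ : ∃ t : ℝ, 0 < t ∧ t ≤ 1 ∧
        (1 - t) * RX + t * B < RX + ε ∧ (1 - t) * RY + t * B < RY + ε := by
      refine ⟨min 1 (ε / (2 * (|B - RX| + |B - RY| + 1))), ?_, min_le_left _ _, ?_, ?_⟩
      · positivity
      all_goals
        have h1 := min_le_right 1 (ε / (2 * (|B - RX| + |B - RY| + 1)))
        have h0 : 0 < min 1 (ε / (2 * (|B - RX| + |B - RY| + 1))) := by positivity
        set t := min 1 (ε / (2 * (|B - RX| + |B - RY| + 1)))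
        rw [le_div_iff₀ (by positivity)] at h1
        nlinarith [le_abs_self (B - RX), le_abs_self (B - RY), abs_nonneg (B - RX),
          abs_nonneg (B - RY), mul_le_mul_of_nonneg_left (le_abs_self (B - RX)) h0.le,
          mul_le_mul_of_nonneg_left (le_abs_self (B - RY)) h0.le,
          mul_nonneg h0.le (abs_nonneg (B - RX)), mul_nonneg h0.le (abs_nonneg (B - RY))]
    obtain ⟨k, hk, hX, hY, hS, hc⟩ := convex_weightRegion hP hw Λ h hpt (sub_nonneg.2 ht1) ht0.le
      (sub_add_cancel 1 t)
    simp only [Prod.fst_add, Prod.smul_fst, Prod.snd_add, Prod.smul_snd, smul_eq_mul]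
      at hX hY hS hc
    refine achievable_of_lt P W hk (hX.trans_lt (mul_lt_mul_of_pos_right htX hlog))
      (hY.trans_lt (mul_lt_mul_of_pos_right htY hlog))
      (hS.trans_lt (mul_lt_mul_of_pos_right (by linarith) hlog)) (Or.inl (hc.trans_lt ?_)) ha₀.le
    nlinarith
  · obtain ⟨k, hk, hX, hY, hS, hc⟩ := h
    -- Now every action costs at least `Γ` while the mean is at most `Γ`, so actions of positive
    -- probability cost exactly `Γ`.
    push Not at hmin
    have hm := margA_nonneg hP.1 fun x a => (hk x).1 a
    have hms : ∑ a, margA (fun x => (P x).toReal) k a = 1 := by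
      rw [sum_margA fun x => (hk x).2, hP.2]
    have hnn : ∀ a ∈ Finset.univ, 0 ≤ margA (fun x => (P x).toReal) k a * (Λ a - Γ) :=
      fun a _ => mul_nonneg (hm a) (sub_nonneg.2 (hmin a))
    have hle : ∑ a, margA (fun x => (P x).toReal) k a * (Λ a - Γ) ≤ 0 := by
      rw [Finset.sum_comm] at hc
      simp only [mul_sub, Finset.sum_sub_distrib, ← Finset.sum_mul, hms]
      simp only [margA, Finset.sum_mul]
      linarith
    have hzero := (Finset.sum_eq_zero_iff_of_nonneg hnn).1
      (le_antisymm hle (Finset.sum_nonneg hnn))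
    have hused : ∀ a, 0 < margA (fun x => (P x).toReal) k a → Λ a ≤ Γ := by
      intro a ha
      have := (mul_eq_zero.1 (hzero a (Finset.mem_univ a))).resolve_left ha.ne'
      linarith
    obtain ⟨a₀, -, ha₀⟩ := Finset.exists_ne_zero_of_sum_ne_zero (hms.trans_ne one_ne_zero)
    refine achievable_of_lt P W hk (hX.trans_lt (mul_lt_mul_of_pos_right ?_ hlog))
      (hY.trans_lt (mul_lt_mul_of_pos_right ?_ hlog))
      (hS.trans_lt (mul_lt_mul_of_pos_right ?_ hlog)) (Or.inr hused)
      (hused a₀ ((hm a₀).lt_of_ne' ha₀)) <;> simp <;> linarith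

end Achievability

end ActionCoding

/-! ### The two descriptions of the optimal region. -/

theorem theorem1 {X A Y : Type*} [Fintype X] [Fintype A] [Fintype Y]
    (P : PMF X) (W : X → A → PMF Y) (Λ : A → ℝ) :
    (∀ Γ : ℝ, ActionCoding.optimalRateRegion P W Λ Γ =
      {R : ℝ × ℝ | (R.1, R.2, Γ) ∈ closure (ActionCoding.singleLetterRegion P W Λ)}) ∧
    ActionCoding.optimalTripleRegion P W Λ =
      closure (ActionCoding.singleLetterRegion P W Λ) := by
  have hP := ActionCoding.toReal_mem_stdSimplex P
  have hw := fun x a => ActionCoding.toReal_mem_stdSimplex (W x a)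
  have hclosed := ActionCoding.isClosed_weightRegion hP hw Λ
  have hconv := ActionCoding.convex_weightRegion hP hw Λ
  rw [ActionCoding.singleLetterRegion_eq_weightRegion, hclosed.closure_eq]
  have hseq : ∀ r : ℝ, Filter.Tendsto (fun n : ℕ => r + 1 / ((n : ℝ) + 1)) Filter.atTop (𝓝 r) :=
    fun r => by
      simpa using (tendsto_one_div_add_atTop_nhds_zero_nat (𝕜 := ℝ)).const_add r
  refine ⟨fun Γ => Set.Subset.antisymm ?_ ?_, Set.Subset.antisymm ?_ ?_⟩
  · refine closure_minimal (convexHull_min ?_ ?_) ?_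
    · exact fun R hR => ActionCoding.mem_weightRegion_of_achievable hR
    · intro R hR R' hR' s t hs ht hst
      have := hconv hR hR' hs ht hst
      simpa [← add_mul, hst] using this
    · exact hclosed.preimage (by fun_prop : Continuous fun R : ℝ × ℝ => (R.1, R.2, Γ))
  · intro R hR
    -- Only the rates are perturbed, by 1/(n+1); the approximating pairs stay in the slice at `Γ`.
    refine mem_closure_of_tendsto ((hseq R.1).prodMk_nhds (hseq R.2))
      (Filter.Eventually.of_forall fun n => subset_convexHull ℝ _ ?_)
    exact ActionCoding.achievable_of_mem_weightRegion hR Nat.one_div_pos_of_nat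
  · refine closure_minimal (convexHull_min ?_ hconv) hclosed
    exact fun r hr => ActionCoding.mem_weightRegion_of_achievable hr
  · intro r hr
    refine mem_closure_of_tendsto
      ((hseq r.1).prodMk_nhds ((hseq r.2.1).prodMk_nhds (tendsto_const_nhds (x := r.2.2))))
      (Filter.Eventually.of_forall fun n => subset_convexHull ℝ _ ?_)
    exact ActionCoding.achievable_of_mem_weightRegion hr Nat.one_div_pos_of_nat
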